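/- All digraphs are finite and have no loops and no parallel arcs. A digraph is strong if every vertex can be reached from every other one by a directed path; it is symmetric if $yx$ is an arc whenever $xy$ is, and semicomplete if any two distinct vertices are joined by at least one arc. For a digraph $Q$ and $S\subseteq V(Q)$, an $S$-strong subgraph of $Q$ is a strong subgraph of $Q$ whose vertex set contains $S$; let $\lambda_S(Q)$ be the maximum number of pairwise arc-disjoint $S$-strong subgraphs of $Q$, and for $2\le k\le |V(Q)|$ let $\lambda_k(Q)=\min\{\lambda_S(Q) : S\subseteq V(Q),\ |S|=k\}$. Let $D$ be a digraph with vertices $u_1,\dots,u_t$, $t\ge 2$, and let $H_1,\dots,H_t$ be digraphs on disjoint vertex sets. Let $n_0=\min_{1\le i\le t}|V(H_i)|$. The composition $Q=D[H_1,\dots,H_t]$ is the digraph with vertex set $\bigcup_i V(H_i)$ whose arcs are all arcs of the $H_i$, together with all arcs $xy$ with $x\in V(H_i)$, $y\in V(H_p)$, $u_iu_p\in A(D)$. Write $\overline{K}_r$ for the digraph with $r$ vertices and no arcs, $\overrightarrow{C}_3$ for the directed 3-cycle and $\overrightarrow{P}_2$ for the directed path on two vertices, and let $$\mathcal{Q}_0=\{\overrightarrow{C}_3[\overline{K}_2,\overline{K}_2,\overline{K}_2],\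 \overrightarrow{C}_3[\overrightarrow{P}_2,\overline{K}_2,\overline{K}_2],\ \overrightarrow{C}_3[\overline{K}_2,\overline{K}_2,\overline{K}_3]\}.$$ **Corollary 4.7.** We have $\lambda_k(Q)\ge n_0$ for all $2\le k\le |V(Q)|$ if one of the following conditions holds: (i) $D$ is a strong symmetric digraph; (ii) $D$ is a strong semicomplete digraph and $Q$ is not isomorphic to a member of $\mathcal{Q}_0$. The bound is sharp in each case: (i) if $D$ is a strong symmetric digraph with at least two vertices in which the minimum of all in-degrees and out-degrees is $1$ (such $D$ exist for every order $t\ge 2$), and $r\ge 1$, then $Q=D[\overline{K}_r,\dots,\overline{K}_r]$ has $n_0=r$ and $\lambda_k(Q)=r$ for all $2\le k\le |V(Q)|$; (ii) if $r\ge 3$, then $Q=\overrightarrow{C}_3[\overline{K}_r,\overline{K}_r,\overline{K}_r]$ satisfies condition (ii), has $n_0=r$, and $\lambda_k(Q)=r$ for all $2\le k\le |V(Q)|$. -/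

import Mathlib

universe u v

namespace StrongPacking

/-- No arc joins a vertex to itself (digraphs here have neither loops nor parallel arcs). -/
def Loopless {V : Type*} (D : Digraph V) : Prop := ∀ v, ¬ D.Adj v v

/-- Every vertex can be reached from every vertex along arcs. -/
def IsStrong {V : Type*} (D : Digraph V) : Prop :=
  ∀ x y, Relation.ReflTransGen D.Adj x y

/-- Every arc comes with its opposite arc. -/
def IsSymmetric {V : Type*} (D : Digraph V) : Prop := ∀ x y, D.Adj x y → D.Adj y x

/-- Any two distinct vertices are joined by at least one arc. -/
def IsSemicomplete {V : Type*} (D : Digraph V) : Prop :=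
  ∀ x y, x ≠ y → D.Adj x y ∨ D.Adj y x

/-- Two digraphs are isomorphic. -/
def Isomorphic {V W : Type*} (D : Digraph V) (E : Digraph W) : Prop :=
  Nonempty (D.Adj ≃r E.Adj)

/-- A subgraph of a digraph: a set of vertices and a set of arcs between them. -/
@[ext]
structure Subgraph {V : Type*} (D : Digraph V) where
  verts : Set V
  Adj : V → V → Prop
  adj_sub : ∀ {x y}, Adj x y → D.Adj x y
  left_mem : ∀ {x y}, Adj x y → x ∈ verts
  right_mem : ∀ {x y}, Adj x y → y ∈ verts

/-- A strong subgraph whose vertex set contains `S`. -/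
def IsSStrong {V : Type*} {D : Digraph V} (S : Finset V) (F : Subgraph D) : Prop :=
  (S : Set V) ⊆ F.verts ∧ ∀ x ∈ F.verts, ∀ y ∈ F.verts, Relation.ReflTransGen F.Adj x y

/-- Two subgraphs have no common arc. -/
def ArcDisjoint {V : Type*} {D : Digraph V} (F G : Subgraph D) : Prop :=
  ∀ x y, ¬ (F.Adj x y ∧ G.Adj x y)

/-- `λ_S(D)`: the maximum number of pairwise arc-disjoint `S`-strong subgraphs of `D`. The
supremum is taken in `ℕ∞`; on a finite vertex type there are finitely many collections, so it is
a maximum. -/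
noncomputable def lambdaSet {V : Type*} (D : Digraph V) (S : Finset V) : ℕ∞ :=
  ⨆ 𝓕 ∈ {𝓕 : Set (Subgraph D) | (∀ F ∈ 𝓕, IsSStrong S F) ∧ 𝓕.Pairwise ArcDisjoint}, 𝓕.encard

/-- `λ_k(D)`: the minimum of `λ_S(D)` over the sets `S` of exactly `k` vertices. -/
noncomputable def lambda {V : Type*} (D : Digraph V) (k : ℕ) : ℕ∞ :=
  ⨅ S ∈ {S : Finset V | S.card = k}, lambdaSet D S

/-- The composition `D[H_i : i]`: its vertices are the pairs `⟨i, a⟩` with `a` a vertex of `H i`;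
there is an arc from `⟨i, a⟩` to `⟨p, b⟩` iff `D` has the arc `i p`, or `i = p` and `H i` has the
arc `a b`. -/
def comp {ι : Type*} {V : ι → Type*} (D : Digraph ι) (H : ∀ i, Digraph (V i)) :
    Digraph (Σ i, V i) where
  Adj := Sigma.Lex D.Adj fun i => (H i).Adj

/-- `n_0`: the least number of vertices of one of the parts. -/
noncomputable def minOrder {ι : Type*} (V : ι → Type*) [∀ i, Fintype (V i)] : ℕ :=
  ⨅ i, Fintype.card (V i)

/-- The minimum, over all vertices, of the out-degrees and the in-degrees. -/
noncomputable def minSemidegree {V : Type*} (D : Digraph V) : ℕ :=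
  min (⨅ v, {w | D.Adj v w}.ncard) (⨅ v, {w | D.Adj w v}.ncard)

/-- The digraph of order `r` with no arcs. -/
def arcless (r : ℕ) : Digraph (Fin r) where
  Adj _ _ := False

/-- The directed cycle `0 → 1 → 2 → 0`. -/
def cycle3 : Digraph (Fin 3) where
  Adj i j := j = i + 1

/-- The directed path `0 → 1` on two vertices. -/
def path2 : Digraph (Fin 2) where
  Adj i j := i = 0 ∧ j = 1

/-- `Q` is, up to isomorphism, one of the three digraphs `C₃[K̄₂, K̄₂, K̄₂]`, `C₃[P₂, K̄₂, K̄₂]`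
and `C₃[K̄₂, K̄₂, K̄₃]`. -/
def IsExceptional {V : Type*} (Q : Digraph V) : Prop :=
  Isomorphic Q (comp cycle3 fun _ => arcless 2) ∨
  Isomorphic Q (comp cycle3 ![path2, arcless 2, arcless 2]) ∨
  Isomorphic Q (comp cycle3 fun i => arcless (![2, 2, 3] i))

end StrongPacking

open StrongPacking

/-!
All the subgraphs constructed here are spanning, so the lower bound asks for `r = n₀` pairwise
arc-disjoint strong spanning subgraphs of the composition (`HasStrongPacking`). Arcs inside the
parts are needed in one case only, and the parts may be assumed to have exactly `r` vertices: a
packing pulls back along a surjection of each part onto `ZMod r` (`HasStrongPacking.pullback`).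

In this blow-up of `D` by `ZMod r`, it suffices to pack the blow-up of a single directed cycle
of `D`. All other arcs `i p` of `D` are distributed among the `r` subgraphs by the shifts
`(i, a) ↦ (p, a + j)`; since `D` is strong, every vertex is joined to the cycle in both directions
within each subgraph (`HasStrongPacking.extend`).

The blow-up of a directed cycle by `ZMod r` has to be decomposed into Hamiltonian cycles, that is,
one chooses a Latin square for each arc of the cycle such that, for every `j`, the product of the
`j`-th rows is a cyclic permutation. Latin squares of shifts suffice for the 2-cycle and the 4-cycle
for all `r`, and for the triangle if `r` is odd or divisible by `4`. For `r ≡ 2 (mod 4)` a parity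
argument rules out shifts on the triangle; modifying one of the Latin squares in three columns works
for `r ≥ 6`. The case `r = 2` of the triangle is impossible.

A strong symmetric digraph has a 2-cycle, and so has a semicomplete digraph that is not a
tournament. A strong tournament has a triangle, and a 4-cycle if it has at least four vertices.
There remains `r = 2` with `D` the directed triangle itself. There the arcs inside the parts and
the vertices in excess of two per part are used: eight small digraphs are decomposed explicitly,
and the compositions that cannot be reduced to one of them are the three exceptional ones.

The bound is attained when `D` has a vertex of out-degree `1`: its copies have out-degree `r` in the
composition, and each of the disjoint subgraphs uses one of these `r` arcs (`lambda_le_outDegree`).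
-/

namespace StrongPacking

open Relation

/-- Pairwise arc-disjoint strong spanning subgraphs of `Q`, indexed by `J`: the arc relation of
the `j`-th one is `F j`, and disjointness is required of different indices. -/
def HasStrongPacking {V : Type*} (Q : Digraph V) (J : Type*) : Prop :=
  ∃ F : J → V → V → Prop, (∀ j x y, F j x y → Q.Adj x y) ∧
    (∀ i j x y, F i x y → F j x y → i = j) ∧ ∀ j x y, ReflTransGen (F j) x y

/-- The balanced composition of `D` with arcless parts, all of them equal to `J`. -/
def blowUp {ι : Type*} (D : Digraph ι) (J : Type*) : Digraph (ι × J) where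
  Adj x y := D.Adj x.1 y.1

/-- The directed cycle `0 → 1 → ⋯ → n - 1 → 0`. -/
def cycleDigraph (n : ℕ) [NeZero n] : Digraph (Fin n) where
  Adj i j := j = i + 1

/-! ### Strong packings and `λ_k` -/

lemma exists_step {V : Type*} {R : V → V → Prop} {x y : V} (h : ReflTransGen R x y)
    (hxy : x ≠ y) : ∃ z, R x z := by
  rcases h.cases_head with h | ⟨z, h, -⟩
  · exact absurd h hxy
  · exact ⟨z, h⟩

theorem HasStrongPacking.card_le_lambda {V J : Type*} [Fintype J] {Q : Digraph V}
    (h : HasStrongPacking Q J) {k : ℕ} (hk : 2 ≤ k) : (Fintype.card J : ℕ∞) ≤ lambda Q k := by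
  obtain ⟨F, hQ, hdis, hstr⟩ := h
  refine le_iInf₂ fun S (hS : S.card = k) => ?_
  obtain ⟨x, -, y, -, hxy⟩ := Finset.one_lt_card.mp (by omega : 1 < S.card)
  let G : J → Subgraph Q := fun j =>
    { verts := Set.univ, Adj := F j, adj_sub := fun h => hQ j _ _ h
      left_mem := fun _ => trivial, right_mem := fun _ => trivial }
  have hG : Function.Injective G := by
    intro i j hij
    obtain ⟨z, hz⟩ := exists_step (hstr i x y) hxy
    have : (G i).Adj = (G j).Adj := by rw [hij]
    exact hdis i j x z hz (by
      have h2 : (G j).Adj x z := this ▸ hz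
      exact h2)
  refine le_trans (le_of_eq ?_) (le_iSup₂ (f := fun (𝓕 : Set (Subgraph Q))
    (_ : 𝓕 ∈ {𝓕 : Set (Subgraph Q) | (∀ F ∈ 𝓕, IsSStrong S F) ∧ 𝓕.Pairwise ArcDisjoint}) =>
      𝓕.encard) (Set.range G) ⟨?_, ?_⟩)
  · rw [← Set.image_univ, hG.encard_image, Set.encard_univ, ENat.card_eq_coe_fintype_card]
  · rintro _ ⟨j, rfl⟩
    exact ⟨fun _ _ => trivial, fun a _ b _ => hstr j a b⟩
  · rintro _ ⟨i, rfl⟩ _ ⟨j, rfl⟩ hne a b ⟨h1, h2⟩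
    exact hne (congrArg G (hdis i j a b h1 h2))

/-- Each of the disjoint subgraphs uses an out-arc of a given vertex `x` of `S`. -/
theorem lambda_le_outDegree {V : Type*} [Fintype V] (Q : Digraph V) (x : V) {k : ℕ}
    (hk : 2 ≤ k) (hkV : k ≤ Fintype.card V) : lambda Q k ≤ {y | Q.Adj x y}.encard := by
  obtain ⟨S, hxS, -, hS⟩ := Finset.exists_subsuperset_card_eq (Finset.subset_univ {x})
    (by rw [Finset.card_singleton]; omega) hkV
  refine (iInf₂_le S hS).trans (iSup₂_le fun 𝓕 h𝓕 => ?_)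
  obtain ⟨hstr, hdis⟩ := h𝓕
  have hx : x ∈ S := by simpa using hxS
  obtain ⟨y, hy, hxy⟩ := Finset.exists_mem_ne (by omega : 1 < S.card) x
  have hex : ∀ F : Subgraph Q, F ∈ 𝓕 → ∃ z, F.Adj x z := fun F hF =>
    exists_step ((hstr F hF).2 x ((hstr F hF).1 hx) y ((hstr F hF).1 hy)) hxy.symm
  have : Nonempty V := ⟨x⟩
  choose! g hg using hex
  refine Set.encard_le_encard_of_injOn (f := g) (fun F hF => F.adj_sub (hg F hF)) ?_
  intro F hF G hG hFG
  by_contra hne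
  exact hdis hF hG hne x (g F) ⟨hg F hF, hFG ▸ hg G hG⟩

/-! ### Operations on packings -/

/-- Pulling a packing back along a surjection. A nontrivial path of the target lifts to a path
with any prescribed end points in the fibres, since consecutive fibres are completely joined. -/
theorem HasStrongPacking.pullback {V W J : Type*} [Nontrivial W] {Q : Digraph V} {R : Digraph W}
    (h : HasStrongPacking R J) (f : V → W) (hf : Function.Surjective f)
    (hRQ : ∀ x y, R.Adj (f x) (f y) → Q.Adj x y) : HasStrongPacking Q J := by
  obtain ⟨F, hR, hdis, hstr⟩ := h
  refine ⟨fun j x y => F j (f x) (f y), fun j x y h => hRQ x y (hR j _ _ h),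
    fun i j x y => hdis i j _ _, fun j x y => ?_⟩
  have key : ∀ a b, TransGen (F j) a b → ∀ x, f x = a → ∀ y, f y = b →
      ReflTransGen (fun x y => F j (f x) (f y)) x y := by
    intro a b hab
    induction hab with
    | single h => rintro x rfl y rfl; exact ReflTransGen.single h
    | @tail b c _ hbc ih =>
      rintro x rfl y rfl
      obtain ⟨z, rfl⟩ := hf b
      exact (ih x rfl z rfl).tail hbc
  refine key (f x) (f y) ?_ x rfl y rfl
  obtain ⟨c, hc⟩ := exists_ne (f x)
  obtain ⟨z, hz⟩ := exists_step (hstr j (f x) c) hc.symm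
  exact TransGen.head' hz (hstr j z (f y))

/-- A packing of the blow-up of a subdigraph `D'` extends to the blow-up of a strong digraph `D`:
the arcs `i p` of `D` that do not lie inside `D'` contribute to the `j`-th subgraph the perfect
matching `(i, a) ↦ (p, a + j)`, along which paths of `D` to and from `D'` lift. -/
theorem HasStrongPacking.extend {κ ι J : Type*} [AddGroup J] {D' : Digraph κ} {D : Digraph ι}
    (hD : IsStrong D) (f : κ → ι) (hf : Function.Injective f) [Nonempty κ]
    (hadj : ∀ a b, D'.Adj a b → D.Adj (f a) (f b)) (h : HasStrongPacking (blowUp D' J) J) :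
    HasStrongPacking (blowUp D J) J := by
  obtain ⟨F, hQ, hdis, hstr⟩ := h
  let G : J → ι × J → ι × J → Prop := fun j x y =>
    (∃ k l, f k = x.1 ∧ f l = y.1 ∧ F j (k, x.2) (l, y.2)) ∨
      (¬ (x.1 ∈ Set.range f ∧ y.1 ∈ Set.range f) ∧ D.Adj x.1 y.1 ∧ y.2 = x.2 + j)
  have hbase : ∀ j (x y : κ × J), ReflTransGen (G j) (f x.1, x.2) (f y.1, y.2) := fun j x y =>
    ReflTransGen.lift (p := G j) (fun x : κ × J => ((f x.1, x.2) : ι × J))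
      (fun a b hab => Or.inl ⟨a.1, b.1, rfl, rfl, hab⟩) x y (hstr j x y)
  have hto : ∀ j i p, ReflTransGen D.Adj i p → p ∈ Set.range f → ∀ a, ∃ k b,
      ReflTransGen (G j) (i, a) (f k, b) := by
    intro j i p hip hp
    induction hip using ReflTransGen.head_induction_on with
    | refl => obtain ⟨k, rfl⟩ := hp; exact fun a => ⟨k, a, ReflTransGen.refl⟩
    | @head i q hiq _ ih =>
      intro a
      by_cases hi : i ∈ Set.range f
      · obtain ⟨k, rfl⟩ := hi; exact ⟨k, a, ReflTransGen.refl⟩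
      · obtain ⟨k, b, hb⟩ := ih (a + j)
        exact ⟨k, b, hb.head (Or.inr ⟨fun h => hi h.1, hiq, rfl⟩)⟩
  have hfrom : ∀ j i p, ReflTransGen D.Adj i p → i ∈ Set.range f → ∀ a, ∃ k b,
      ReflTransGen (G j) (f k, b) (p, a) := by
    intro j i p hip hi
    induction hip with
    | refl => obtain ⟨k, rfl⟩ := hi; exact fun a => ⟨k, a, ReflTransGen.refl⟩
    | @tail q p _ hqp ih =>
      intro a
      by_cases hp : p ∈ Set.range f
      · obtain ⟨k, rfl⟩ := hp; exact ⟨k, a, ReflTransGen.refl⟩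
      · obtain ⟨k, b, hb⟩ := ih (a - j)
        exact ⟨k, b, hb.tail (Or.inr ⟨fun h => hp h.2, hqp, (sub_add_cancel a j).symm⟩)⟩
  obtain ⟨k₀⟩ := ‹Nonempty κ›
  refine ⟨G, ?_, ?_, ?_⟩
  · rintro j ⟨i, a⟩ ⟨p, b⟩ (⟨k, l, rfl, rfl, h⟩ | ⟨-, h, -⟩)
    · exact hadj _ _ (hQ j _ _ h)
    · exact h
  · rintro i j ⟨p, a⟩ ⟨q, b⟩ (⟨k, l, hk, hl, h⟩ | ⟨hn, -, h⟩)
      (⟨k', l', hk', hl', h'⟩ | ⟨hn', -, h'⟩)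
    · obtain rfl := hf (hk.trans hk'.symm)
      obtain rfl := hf (hl.trans hl'.symm)
      exact hdis i j _ _ h h'
    · exact absurd ⟨⟨k, hk⟩, ⟨l, hl⟩⟩ hn'
    · exact absurd ⟨⟨k', hk'⟩, ⟨l', hl'⟩⟩ hn
    · exact add_left_cancel (h.symm.trans h')
  · rintro j ⟨i, a⟩ ⟨p, b⟩
    obtain ⟨k, c, hc⟩ := hto j i (f k₀) (hD _ _) ⟨k₀, rfl⟩ a
    obtain ⟨l, d, hd⟩ := hfrom j (f k₀) p (hD _ _) ⟨k₀, rfl⟩ b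
    exact hc.trans ((hbase j (k, c) (l, d)).trans hd)

/-- Parts with at least `|J|` vertices are mapped onto `J`. -/
theorem HasStrongPacking.comp {ι : Type*} {V : ι → Type*} [∀ i, Fintype (V i)] {J : Type*}
    [Fintype J] [Nonempty J] [Nontrivial ι] {D : Digraph ι} (H : ∀ i, Digraph (V i))
    (hV : ∀ i, Fintype.card J ≤ Fintype.card (V i)) (h : HasStrongPacking (blowUp D J) J) :
    HasStrongPacking (StrongPacking.comp D H) J := by
  have hs : ∀ i, ∃ g : V i → J, Function.Surjective g := fun i => by
    obtain ⟨e⟩ := Function.Embedding.nonempty_of_card_le (hV i)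
    exact ⟨Function.invFun e, Function.invFun_surjective e.injective⟩
  choose g hg using hs
  refine h.pullback (fun x => (x.1, g x.1 x.2)) ?_ ?_
  · rintro ⟨i, a⟩
    obtain ⟨b, rfl⟩ := hg i a
    exact ⟨⟨i, b⟩, rfl⟩
  · rintro ⟨i, a⟩ ⟨p, b⟩ h
    exact Sigma.Lex.left _ _ h

/-! ### Blow-ups of directed cycles -/

open Fin.NatCast Fin.CommRing in
/-- A blow-up of a directed cycle is packed by the subgraphs in which the arcs from the `i`-th
part form the graph of the permutation `P i j`, if for each `j` the effect `T j` of going once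
around the cycle is a cyclic permutation. -/
theorem hasStrongPacking_blowUp_cycle {n : ℕ} [NeZero n] {J : Type*}
    (P : Fin n → J → Equiv.Perm J) (hP : ∀ i a, Function.Injective fun j => P i j a)
    (T : J → J → J)
    (hT : ∀ j a, ReflTransGen (fun x y : Fin n × J => y = (x.1 + 1, P x.1 j x.2))
      (0, a) (0, T j a))
    (hcyc : ∀ j a b, ReflTransGen (fun x y => y = T j x) a b) :
    HasStrongPacking (blowUp (cycleDigraph n) J) J := by
  set F : J → Fin n × J → Fin n × J → Prop := fun j x y => y = (x.1 + 1, P x.1 j x.2) with hF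
  have hto : ∀ j (k : ℕ) (i : Fin n) a, ∃ b, ReflTransGen (F j) (i, a) (i + (k : Fin n), b) := by
    intro j k i a
    induction k with
    | zero => exact ⟨a, by simpa using ReflTransGen.refl⟩
    | succ k ih =>
      obtain ⟨b, hb⟩ := ih
      exact ⟨_, hb.tail (by simp only [hF, Nat.cast_succ, add_assoc]; rfl)⟩
  have hfrom : ∀ j (k : ℕ) (i : Fin n) a, ∃ b,
      ReflTransGen (F j) (i, b) (i + (k : Fin n), a) := by
    intro j k i a
    induction k generalizing a with
    | zero => exact ⟨a, by simpa using ReflTransGen.refl⟩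
    | succ k ih =>
      obtain ⟨b, hb⟩ := ih ((P (i + (k : Fin n)) j).symm a)
      exact ⟨b, hb.tail (by simp [hF, add_assoc])⟩
  have hround : ∀ j a b, ReflTransGen (F j) (0, a) (0, b) := by
    intro j a b
    induction hcyc j a b with
    | refl => exact ReflTransGen.refl
    | tail _ h ih => subst h; exact ih.trans (hT j _)
  refine ⟨F, ?_, ?_, ?_⟩
  · rintro j x y rfl
    rfl
  · rintro i j x y h h'
    exact hP x.1 x.2 (congrArg Prod.snd (h.symm.trans h'))
  · rintro j ⟨i, a⟩ ⟨p, b⟩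
    obtain ⟨c, hc⟩ := hto j (-i).val i a
    obtain ⟨d, hd⟩ := hfrom j p.val 0 b
    rw [Fin.cast_val_eq_self, add_neg_cancel] at hc
    rw [Fin.cast_val_eq_self, zero_add] at hd
    exact hc.trans ((hround j c d).trans hd)

/-! ### Hamiltonian decompositions of blown-up cycles -/

lemma zmod_reach {r : ℕ} [NeZero r] {u : ZMod r} (hu : IsUnit u) (a b : ZMod r) :
    ReflTransGen (fun x y => y = x + u) a b := by
  have key : ∀ k : ℕ, ReflTransGen (fun x y => y = x + u) a (a + k * u) := by
    intro k
    induction k with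
    | zero => simpa using ReflTransGen.refl
    | succ k ih => exact ih.tail (by push_cast; ring)
  have h := key ((b - a) * u⁻¹).val
  rwa [ZMod.natCast_zmod_val, mul_assoc, ZMod.inv_mul_of_unit u hu, mul_one,
    add_sub_cancel] at h

/-- A permutation of a finite set all of whose points lie on the forward orbit of `x₀` is
cyclic. -/
lemma perm_reach {J : Type*} [Finite J] (σ : Equiv.Perm J) (x₀ : J)
    (h : ∀ x, ReflTransGen (fun x y => y = σ x) x₀ x) (a b : J) :
    ReflTransGen (fun x y => y = σ x) a b := by
  have hs : ∀ x, σ.SameCycle x₀ x := fun x => by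
    induction h x with
    | refl => exact Equiv.Perm.SameCycle.refl _ _
    | tail _ h ih => subst h; exact Equiv.Perm.sameCycle_apply_right.mpr ih
  obtain ⟨n, rfl⟩ := ((hs a).symm.trans (hs b)).exists_nat_pow_eq
  induction n with
  | zero => exact ReflTransGen.refl
  | succ n ih => exact ih.tail (by rw [pow_succ']; rfl)

theorem hasStrongPacking_blowUp_cycle_two (r : ℕ) [NeZero r] :
    HasStrongPacking (blowUp (cycleDigraph 2) (ZMod r)) (ZMod r) := by
  refine hasStrongPacking_blowUp_cycle
    ![fun j => Equiv.addRight j, fun j => Equiv.addRight (1 - j)] ?_ (fun _ x => x + 1) ?_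
    fun _ => zmod_reach isUnit_one
  · intro i a j j'
    fin_cases i <;> simp
  · refine fun j a => ReflTransGen.tail (b := (1, a + j)) (ReflTransGen.single rfl) ?_
    simp [add_assoc]

theorem hasStrongPacking_blowUp_cycle_four (r : ℕ) [NeZero r] :
    HasStrongPacking (blowUp (cycleDigraph 4) (ZMod r)) (ZMod r) := by
  refine hasStrongPacking_blowUp_cycle
    ![fun j => Equiv.addRight j, fun j => Equiv.addRight (-j), fun j => Equiv.addRight j,
      fun j => Equiv.addRight (1 - j)] ?_ (fun _ x => x + 1) ?_
    fun _ => zmod_reach isUnit_one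
  · intro i a j j'
    fin_cases i <;> simp
  · intro j a
    refine ReflTransGen.tail (b := (3, a + j + -j + j)) (ReflTransGen.tail
      (b := (2, a + j + -j)) (ReflTransGen.tail (b := (1, a + j))
        (ReflTransGen.single ?_) ?_) ?_) ?_
    · rfl
    · rfl
    · rfl
    · simp [add_assoc]

/-- Three permutations `a`, `b`, `c` of `ZMod r` whose sum takes only unit values give a
decomposition of the blow-up of the directed triangle into Hamiltonian cycles. -/
theorem hasStrongPacking_blowUp_cycle_three_of_sum {r : ℕ} [NeZero r] (a b c : ZMod r → ZMod r)
    (ha : Function.Injective a) (hb : Function.Injective b) (hc : Function.Injective c)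
    (hu : ∀ j, IsUnit (a j + b j + c j)) :
    HasStrongPacking (blowUp (cycleDigraph 3) (ZMod r)) (ZMod r) := by
  refine hasStrongPacking_blowUp_cycle
    ![fun j => Equiv.addRight (a j), fun j => Equiv.addRight (b j),
      fun j => Equiv.addRight (c j)] ?_ (fun j x => x + (a j + b j + c j)) ?_
    fun j => zmod_reach (hu j)
  · intro i x j j'
    fin_cases i
    · simpa using @ha j j'
    · simpa using @hb j j'
    · simpa using @hc j j'
  · intro j x
    refine ReflTransGen.tail (b := (2, x + a j + b j))
      (ReflTransGen.tail (b := (1, x + a j)) (ReflTransGen.single ?_) ?_) ?_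
    · rfl
    · rfl
    · simp [add_assoc]

theorem hasStrongPacking_blowUp_cycle_three_of_odd (r : ℕ) [NeZero r] (hr : Odd r) :
    HasStrongPacking (blowUp (cycleDigraph 3) (ZMod r)) (ZMod r) := by
  have h2 : IsUnit (2 : ZMod r) := by
    have := (ZMod.isUnit_iff_coprime 2 r).mpr (Nat.coprime_two_left.mpr hr)
    simpa using this
  refine hasStrongPacking_blowUp_cycle_three_of_sum id id (fun j => 1 - 2 * j)
    Function.injective_id Function.injective_id ?_ ?_
  · intro j j' h
    exact h2.mul_left_cancel (sub_right_injective h)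
  · intro j
    simp only [id]
    ring_nf
    exact isUnit_one

lemma zmod_natCast_injective {r : ℕ} [NeZero r] (f : ℕ → ℕ) (hf : ∀ v < r, f v < r)
    (hinj : ∀ v < r, ∀ w < r, f v = f w → v = w) :
    Function.Injective fun j : ZMod r => (f j.val : ZMod r) := by
  intro j j' h
  have h' := congrArg ZMod.val h
  simp only [ZMod.val_natCast_of_lt (hf _ (ZMod.val_lt _))] at h'
  exact ZMod.val_injective r (hinj _ (ZMod.val_lt _) _ (ZMod.val_lt _) h')

/-- For even `r`, the values of a permutation of `ZMod r` add up to `r / 2`, and so do those of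
three permutations together; hence the sums `a j + b j + c j` cannot all be `1`. Here they are `1`
except that one of them is `r / 2 + 1`, which is a unit because `4 ∣ r`. -/
theorem hasStrongPacking_blowUp_cycle_three_of_four_dvd (n : ℕ) (hn : 0 < n) :
    HasStrongPacking (blowUp (cycleDigraph 3) (ZMod (4 * n))) (ZMod (4 * n)) := by
  have : NeZero (4 * n) := ⟨by omega⟩
  have h0 : (4 * n : ZMod (4 * n)) = 0 := by exact_mod_cast ZMod.natCast_self (4 * n)
  let b : ℕ → ℕ := fun v => if v = 0 then 2 * n + 1 else if v < 2 * n then v + 1 else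
    if v + 1 = 4 * n then 1 else if v + 2 = 4 * n then 0 else v + 2
  let c : ℕ → ℕ := fun v => if v < 2 * n then 2 * v else 2 * v + 1 - 4 * n
  refine hasStrongPacking_blowUp_cycle_three_of_sum id (fun j => (b j.val : ZMod (4 * n)))
    (fun j => -(c j.val : ZMod (4 * n))) Function.injective_id
    (zmod_natCast_injective b ?_ ?_) (neg_injective.comp (zmod_natCast_injective c ?_ ?_)) ?_
  · intro v hv; dsimp only [b]; split_ifs <;> omega
  · intro v hv w hw h; dsimp only [b] at h; split_ifs at h <;> omega
  · intro v hv; dsimp only [c]; split_ifs <;> omega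
  · intro v hv w hw h; dsimp only [c] at h; split_ifs at h <;> omega
  · intro j
    have hj := ZMod.natCast_zmod_val j
    have hlt := ZMod.val_lt j
    set v := j.val with hv
    have key : (id j + (b v : ZMod (4 * n)) + -(c v : ZMod (4 * n)) =
        ((if v = 0 then 2 * n + 1 else 1 : ℕ) : ZMod (4 * n))) := by
      have hnat : v + b v + 4 * n * (if v < 2 * n then 0 else if v + 2 < 4 * n then 0 else 1) =
          c v + (if v = 0 then 2 * n + 1 else 1) + 4 * n * (if v < 2 * n then 0 else 1) := by
        dsimp only [b, c]; split_ifs <;> omega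
      have := congrArg (Nat.cast (R := ZMod (4 * n))) hnat
      push_cast [h0] at this
      push_cast
      rw [id, ← hj]
      linear_combination this
    rw [key, ZMod.isUnit_iff_coprime]
    split_ifs
    · have h1 : Nat.Coprime (2 * n + 1) (2 * n) := by simp
      have h2 : Nat.Coprime (2 * n + 1) 2 := by simp
      exact (h2.mul_right h1).coprime_dvd_right ⟨1, by ring⟩
    · exact Nat.coprime_one_left _

/-- For `r ≡ 2 (mod 4)` shifts do not suffice. Here the arcs leaving part `0` use the Latin square
whose row `j` is `x ↦ τ x + j`, where `τ` is the transposition `(0 1)` for even `j` and the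
`3`-cycle `(0 1 2)` for odd `j`, and the other two parts use shifts, such that going once around
the triangle has the effect `x ↦ τ x + 2` or `x ↦ τ x + 1`, respectively. Both are Hamiltonian
cycles. -/
theorem hasStrongPacking_blowUp_cycle_three_of_two_mod_four (m : ℕ) (hm : Odd m) (hm3 : 3 ≤ m) :
    HasStrongPacking (blowUp (cycleDigraph 3) (ZMod (2 * m))) (ZMod (2 * m)) := by
  have : NeZero (2 * m) := ⟨by omega⟩
  have hr0 : ((2 * m : ℕ) : ZMod (2 * m)) = 0 := ZMod.natCast_self (2 * m)
  have hne : ∀ v w : ℕ, v < 2 * m → w < 2 * m → v ≠ w → (v : ZMod (2 * m)) ≠ w := by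
    intro v w hv hw hvw h
    have h' := congrArg ZMod.val h
    rw [ZMod.val_natCast_of_lt hv, ZMod.val_natCast_of_lt hw] at h'
    exact hvw h'
  have h01 : (0 : ZMod (2 * m)) ≠ 1 := by exact_mod_cast hne 0 1 (by omega) (by omega) (by omega)
  have h02 : (0 : ZMod (2 * m)) ≠ 2 := by exact_mod_cast hne 0 2 (by omega) (by omega) (by omega)
  have h12 : (1 : ZMod (2 * m)) ≠ 2 := by exact_mod_cast hne 1 2 (by omega) (by omega) (by omega)
  -- reduction modulo `2`: parity is well defined in `ZMod (2 * m)`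
  have hpar : ∀ (j j' : ZMod (2 * m)) (s s' : ℕ), j + s = j' + s' →
      (j.val + s) % 2 = (j'.val + s') % 2 := by
    intro j j' s s' h
    have h1 : ((j.val + s : ℕ) : ZMod (2 * m)) = ((j'.val + s' : ℕ) : ZMod (2 * m)) := by
      push_cast; simpa using h
    rw [ZMod.natCast_eq_natCast_iff] at h1
    exact h1.of_mul_right m
  let τ : ZMod (2 * m) → Equiv.Perm (ZMod (2 * m)) := fun j =>
    if j.val % 2 = 0 then Equiv.swap 0 1 else Equiv.swap 0 1 * Equiv.swap 1 2
  let s : ZMod (2 * m) → ℕ := fun j => if j.val % 2 = 0 then 2 else 1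
  have hτ0 : ∀ j, τ j 0 = 1 := fun j => by
    dsimp only [τ]; split_ifs
    · simp
    · simp [Equiv.swap_apply_of_ne_of_ne h01 h02]
  have hτ1 : ∀ j, τ j 1 = if j.val % 2 = 0 then 0 else 2 := fun j => by
    dsimp only [τ]; split_ifs
    · simp
    · simp [Equiv.swap_apply_of_ne_of_ne h02.symm h12.symm]
  have hτ2 : ∀ j, τ j 2 = if j.val % 2 = 0 then 2 else 0 := fun j => by
    dsimp only [τ]; split_ifs
    · simp [Equiv.swap_apply_of_ne_of_ne h02.symm h12.symm]
    · simp
  have hτ : ∀ j x, x ≠ 0 → x ≠ 1 → x ≠ 2 → τ j x = x := fun j x h0 h1 h2 => by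
    dsimp only [τ]; split_ifs
    · simp [Equiv.swap_apply_of_ne_of_ne h0 h1]
    · simp [Equiv.swap_apply_of_ne_of_ne h0 h1, Equiv.swap_apply_of_ne_of_ne h1 h2]
  have hLatin : ∀ x, Function.Injective fun j => τ j x + j := by
    intro x j j' h
    dsimp only at h
    by_cases hx0 : x = 0
    · subst hx0; simpa [hτ0] using h
    by_cases hx1 : x = 1
    · subst hx1
      rw [hτ1, hτ1] at h
      have hp := hpar j j' (if j.val % 2 = 0 then 0 else 2) (if j'.val % 2 = 0 then 0 else 2)
        (by push_cast; rwa [add_comm j, add_comm j'])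
      have hiff : j.val % 2 = 0 ↔ j'.val % 2 = 0 := by split_ifs at hp <;> omega
      simpa [hiff] using h
    by_cases hx2 : x = 2
    · subst hx2
      rw [hτ2, hτ2] at h
      have hp := hpar j j' (if j.val % 2 = 0 then 2 else 0) (if j'.val % 2 = 0 then 2 else 0)
        (by push_cast; rwa [add_comm j, add_comm j'])
      have hiff : j.val % 2 = 0 ↔ j'.val % 2 = 0 := by split_ifs at hp <;> omega
      simpa [hiff] using h
    · simpa [hτ _ x hx0 hx1 hx2] using h
  -- `m` is odd, so an element of `ZMod (2 * m)` is determined by its double and its parity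
  have hb : Function.Injective fun j : ZMod (2 * m) => (s j : ZMod (2 * m)) - 2 * j := by
    intro j j' h
    have h1 : ((s j + 2 * j'.val : ℕ) : ZMod (2 * m)) = ((s j' + 2 * j.val : ℕ) : _) := by
      push_cast
      simp only [ZMod.natCast_zmod_val]
      linear_combination h
    rw [ZMod.natCast_eq_natCast_iff] at h1
    have h2 : (s j + 2 * j'.val) % 2 = (s j' + 2 * j.val) % 2 := h1.of_mul_right m
    have hs : s j = s j' ∧ j.val % 2 = j'.val % 2 := by
      dsimp only [s] at h2 ⊢; split_ifs at h2 ⊢ <;> omega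
    rw [hs.1] at h1
    have h3 := Nat.ModEq.add_left_cancel' _ h1
    have h4 : j'.val ≡ j.val [MOD m] := Nat.ModEq.mul_left_cancel' (by norm_num) h3
    have h5 : j'.val ≡ j.val [MOD 2 * m] :=
      (Nat.modEq_and_modEq_iff_modEq_mul (Nat.coprime_two_left.mpr hm)).mp ⟨hs.2.symm, h4⟩
    have h6 := Nat.ModEq.eq_of_lt_of_lt h5 (ZMod.val_lt _) (ZMod.val_lt _)
    exact ZMod.val_injective _ h6.symm
  refine hasStrongPacking_blowUp_cycle
    ![fun j => (τ j).trans (Equiv.addRight j), fun j => Equiv.addRight j,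
      fun j => Equiv.addRight ((s j : ZMod (2 * m)) - 2 * j)] ?_
    (fun j => (τ j).trans (Equiv.addRight (s j : ZMod (2 * m)))) ?_
    fun j => perm_reach _ 0 ?_
  · intro i x j j'
    fin_cases i
    · exact @hLatin x j j'
    · simp
    · simpa using @hb j j'
  · intro j x
    refine ReflTransGen.tail (b := (2, τ j x + j + j))
      (ReflTransGen.tail (b := (1, τ j x + j)) (ReflTransGen.single ?_) ?_) ?_
    · rfl
    · rfl
    · refine Prod.ext rfl ?_
      change τ j x + s j = τ j x + j + j + (s j - 2 * j)
      ring
  · set R : ZMod (2 * m) → ZMod (2 * m) → Prop :=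
      fun x y => y = (τ j).trans (Equiv.addRight (s j : ZMod (2 * m))) x with hR
    have hstep : ∀ x, ReflTransGen R 0 x → ReflTransGen R 0 (τ j x + s j) :=
      fun x hx => hx.tail rfl
    have hbig : ∀ v : ℕ, 3 ≤ v → v < 2 * m → ReflTransGen R 0 (v : ZMod (2 * m)) →
        ReflTransGen R 0 ((v + s j : ℕ) : ZMod (2 * m)) := by
      intro v hv hv' h
      have := hstep _ h
      rw [hτ j _ (by exact_mod_cast hne v 0 hv' (by omega) (by omega))
        (by exact_mod_cast hne v 1 hv' (by omega) (by omega))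
        (by exact_mod_cast hne v 2 hv' (by omega) (by omega))] at this
      exact_mod_cast this
    suffices h : ∀ v : ℕ, v < 2 * m → ReflTransGen R 0 (v : ZMod (2 * m)) by
      intro x
      have := h x.val (ZMod.val_lt x)
      rwa [ZMod.natCast_zmod_val] at this
    have r0 : ReflTransGen R 0 0 := ReflTransGen.refl
    by_cases hj : j.val % 2 = 0
    · -- `0 → 3 → 5 → ⋯ → 1 → 2 → 4 → ⋯ → 0`
      have hs : s j = 2 := if_pos hj
      rw [hs] at hbig hstep
      have r3 : ReflTransGen R 0 (3 : ℕ) := by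
        have := hstep _ r0
        rw [hτ0] at this
        convert this using 1
        push_cast; ring
      have rodd : ∀ k : ℕ, 2 * k + 3 ≤ 2 * m + 1 → ReflTransGen R 0 ((2 * k + 3 : ℕ) : _) := by
        intro k hk
        induction k with
        | zero => exact r3
        | succ k ih => exact hbig (2 * k + 3) (by omega) (by omega) (ih (by omega))
      have r1 : ReflTransGen R 0 1 := by
        have := rodd (m - 1) (by omega)
        rw [show 2 * (m - 1) + 3 = 2 * m + 1 by omega] at this
        rwa [Nat.cast_add, hr0, zero_add, Nat.cast_one] at this
      have r2 : ReflTransGen R 0 2 := by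
        have := hstep _ r1
        rw [hτ1, if_pos hj, zero_add] at this
        exact_mod_cast this
      have r4 : ReflTransGen R 0 (4 : ℕ) := by
        have := hstep _ r2
        rw [hτ2, if_pos hj] at this
        convert this using 1
        push_cast; ring
      have reven : ∀ k : ℕ, 2 * k + 4 < 2 * m → ReflTransGen R 0 ((2 * k + 4 : ℕ) : _) := by
        intro k hk
        induction k with
        | zero => exact r4
        | succ k ih => exact hbig (2 * k + 4) (by omega) (by omega) (ih (by omega))
      intro v hv
      obtain rfl | rfl | rfl | h | h : v = 0 ∨ v = 1 ∨ v = 2 ∨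
          v = 2 * ((v - 3) / 2) + 3 ∨ v = 2 * ((v - 4) / 2) + 4 := by omega
      · simpa using r0
      · simpa using r1
      · simpa using r2
      · rw [h]; exact rodd _ (by omega)
      · rw [h]; exact reven _ (by omega)
    · -- `0 → 2 → 1 → 3 → 4 → 5 → ⋯ → 0`
      have hs : s j = 1 := if_neg hj
      rw [hs] at hbig hstep
      have r2 : ReflTransGen R 0 2 := by
        have := hstep _ r0
        rw [hτ0] at this
        convert this using 1
        push_cast; ring
      have r1 : ReflTransGen R 0 1 := by
        have := hstep _ r2
        rw [hτ2, if_neg hj, zero_add] at this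
        exact_mod_cast this
      have r3 : ReflTransGen R 0 (3 : ℕ) := by
        have := hstep _ r1
        rw [hτ1, if_neg hj] at this
        convert this using 1
        push_cast; ring
      have rall : ∀ k : ℕ, k + 3 < 2 * m → ReflTransGen R 0 ((k + 3 : ℕ) : _) := by
        intro k hk
        induction k with
        | zero => exact r3
        | succ k ih => exact hbig (k + 3) (by omega) (by omega) (ih (by omega))
      intro v hv
      obtain rfl | rfl | rfl | h : v = 0 ∨ v = 1 ∨ v = 2 ∨ v = (v - 3) + 3 := by omega
      · simpa using r0
      · simpa using r1
      · simpa using r2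
      · rw [h]; exact rall _ (by omega)

theorem hasStrongPacking_blowUp_cycle_three (r : ℕ) [NeZero r] (hr : r ≠ 2) :
    HasStrongPacking (blowUp (cycleDigraph 3) (ZMod r)) (ZMod r) := by
  have h0 := NeZero.ne r
  rcases Nat.even_or_odd' r with ⟨m, rfl | rfl⟩
  · rcases Nat.even_or_odd' m with ⟨n, rfl | rfl⟩
    · rw [← mul_assoc]
      exact hasStrongPacking_blowUp_cycle_three_of_four_dvd n (by omega)
    · exact hasStrongPacking_blowUp_cycle_three_of_two_mod_four _ ⟨n, rfl⟩ (by omega)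
  · exact hasStrongPacking_blowUp_cycle_three_of_odd _ ⟨m, rfl⟩

/-! ### Short cycles in strong tournaments -/

lemma exists_adj_leaving {V : Type*} {D : Digraph V} (hD : IsStrong D) (S : Set V)
    {x y : V} (hx : x ∈ S) (hy : y ∉ S) : ∃ a ∈ S, ∃ b ∉ S, D.Adj a b := by
  induction hD x y with
  | refl => exact absurd hx hy
  | @tail b c _ hbc ih =>
    by_cases hb : b ∈ S
    · exact ⟨b, hb, c, hy, hbc⟩
    · exact ih hb

/-- In a strong tournament, some arc leads from an out-neighbour of `v` to an in-neighbour. -/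
theorem exists_triangle {V : Type*} [Nontrivial V] {D : Digraph V} (hl : Loopless D)
    (hD : IsStrong D) (hs : IsSemicomplete D) (h2 : ∀ x y, D.Adj x y → ¬ D.Adj y x) :
    ∃ f : Fin 3 → V, ∀ i, D.Adj (f i) (f (i + 1)) := by
  obtain ⟨v, w, hvw⟩ := exists_pair_ne V
  obtain ⟨o, ho⟩ := exists_step (hD v w) hvw
  obtain ⟨a, ha, b, hb, hab⟩ := exists_adj_leaving hD {x | D.Adj v x} ho (hl v)
  have hbv : D.Adj b v := by
    have hne : b ≠ v := by rintro rfl; exact h2 _ _ ha hab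
    exact (hs b v hne).resolve_right hb
  refine ⟨![v, a, b], fun i => ?_⟩
  fin_cases i
  · exact ha
  · exact hab
  · exact hbv

/-- A vertex off a triangle can be inserted into it unless it dominates the triangle or is
dominated by it; and an arc from a dominated vertex `s` to a dominating vertex `t` closes up to a
4-cycle with an arc of the triangle. -/
theorem exists_fourCycle {V : Type*} [Fintype V] {D : Digraph V} (hV : 4 ≤ Fintype.card V)
    (hl : Loopless D) (hD : IsStrong D) (hs : IsSemicomplete D)
    (h2 : ∀ x y, D.Adj x y → ¬ D.Adj y x) :
    ∃ f : Fin 4 → V, ∀ i, D.Adj (f i) (f (i + 1)) := by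
  have : Nontrivial V := Fintype.one_lt_card_iff_nontrivial.mp (by omega)
  suffices h : ∃ a b c d, D.Adj a b ∧ D.Adj b c ∧ D.Adj c d ∧ D.Adj d a by
    obtain ⟨a, b, c, d, h⟩ := h
    refine ⟨![a, b, c, d], fun i => ?_⟩
    fin_cases i
    exacts [h.1, h.2.1, h.2.2.1, h.2.2.2]
  obtain ⟨f, hf⟩ := exists_triangle hl hD hs h2
  by_contra hno
  push Not at hno
  -- a vertex off the triangle with arcs from and to it could be inserted into the triangle
  have hins : ∀ x, x ∉ Set.range f → ∀ i, D.Adj (f i) x → ∀ k, D.Adj (f k) x := by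
    intro x hx
    have step : ∀ i, D.Adj (f i) x → D.Adj (f (i + 1)) x := by
      intro i hi
      by_contra hn
      have h1 : D.Adj x (f (i + 1)) := (hs _ _ fun h => hx ⟨i + 1, h.symm⟩).resolve_right hn
      have h4 := hf (i + 1 + 1)
      have : i + 1 + 1 + 1 = i := by fin_cases i <;> rfl
      rw [this] at h4
      exact hno _ _ _ _ hi h1 (hf (i + 1)) h4
    intro i hi k
    have h1 := step i hi
    have h3 := step _ h1
    have : k = i ∨ k = i + 1 ∨ k = i + 1 + 1 := by fin_cases i <;> fin_cases k <;> simp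
    rcases this with rfl | rfl | rfl <;> assumption
  -- `S` is the set of vertices off the triangle that are dominated by it
  let S : Set V := {x | x ∉ Set.range f ∧ ∀ k, D.Adj (f k) x}
  obtain ⟨y, hy⟩ : ∃ y, y ∉ Set.range f := by
    by_contra h
    push Not at h
    have := Fintype.card_le_of_surjective f h
    simp at this
    omega
  obtain ⟨_, ⟨i, rfl⟩, s, hsr, his⟩ := exists_adj_leaving hD (Set.range f) ⟨0, rfl⟩ hy
  have hsS : s ∈ S := ⟨hsr, hins s hsr i his⟩
  obtain ⟨s', hs', t, ht, hst⟩ := exists_adj_leaving hD S hsS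
    (fun h : f 0 ∈ S => h.1 ⟨0, rfl⟩)
  have htr : t ∉ Set.range f := by
    rintro ⟨k, rfl⟩
    exact h2 _ _ hst (hs'.2 k)
  have htf : D.Adj t (f 0) := by
    refine (hs _ _ fun h => htr ⟨0, h.symm⟩).resolve_right fun h => ht ⟨htr, hins t htr 0 h⟩
  exact hno (f 1) s' t (f 0) (hs'.2 1) hst htf (hf 0)

/-! ### Isomorphisms of compositions -/

theorem Isomorphic.trans {U V W : Type*} {A : Digraph U} {B : Digraph V} {C : Digraph W}
    (h : Isomorphic A B) (h' : Isomorphic B C) : Isomorphic A C :=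
  h.elim fun e => h'.elim fun e' => ⟨e.trans e'⟩

theorem Isomorphic.isExceptional {U V : Type*} {A : Digraph U} {B : Digraph V}
    (h : Isomorphic A B) (hB : IsExceptional B) : IsExceptional A :=
  hB.imp h.trans (Or.imp h.trans h.trans)

theorem HasStrongPacking.of_isomorphic {V W J : Type*} {Q : Digraph V} {R : Digraph W}
    (h : HasStrongPacking R J) (hQR : Isomorphic Q R) : HasStrongPacking Q J := by
  obtain ⟨F, hR, hdis, hstr⟩ := h
  obtain ⟨e⟩ := hQR
  refine ⟨fun j x y => F j (e x) (e y), fun j x y h => e.map_rel_iff.mp (hR j _ _ h),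
    fun i j x y => hdis i j _ _, fun j x y => ?_⟩
  have := ReflTransGen.lift (p := fun x y => F j (e x) (e y)) e.symm
    (fun a b hab => by simpa [Function.onFun] using hab) (e x) (e y) (hstr j (e x) (e y))
  simpa [Function.onFun] using this

theorem isomorphic_comp_parts {ι : Type*} {V W : ι → Type*} (D : Digraph ι)
    {H : ∀ i, Digraph (V i)} {E : ∀ i, Digraph (W i)} (g : ∀ i, V i ≃ W i)
    (hg : ∀ i x y, (E i).Adj (g i x) (g i y) ↔ (H i).Adj x y) :
    Isomorphic (comp D H) (comp D E) := by
  refine ⟨⟨Equiv.sigmaCongrRight g, ?_⟩⟩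
  rintro ⟨i, a⟩ ⟨p, b⟩
  simp only [comp, Sigma.lex_iff, Equiv.sigmaCongrRight_apply]
  refine or_congr Iff.rfl ⟨?_, ?_⟩
  · rintro ⟨rfl, h⟩
    exact ⟨rfl, (hg _ _ _).mp h⟩
  · rintro ⟨rfl, h⟩
    exact ⟨rfl, (hg _ _ _).mpr h⟩

theorem isomorphic_comp_reindex {ι κ : Type*} {V : ι → Type*} {D : Digraph ι} {D' : Digraph κ}
    (H : ∀ i, Digraph (V i)) (e : κ ≃ ι) (he : ∀ a b, D.Adj (e a) (e b) ↔ D'.Adj a b) :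
    Isomorphic (comp D' fun k => H (e k)) (comp D H) := by
  refine ⟨⟨Equiv.sigmaCongrLeft e, ?_⟩⟩
  rintro ⟨i, a⟩ ⟨p, b⟩
  simp only [comp, Sigma.lex_iff, Equiv.sigmaCongrLeft_apply]
  refine or_congr (he i p) ⟨?_, ?_⟩
  · rintro ⟨h, h'⟩
    obtain rfl := e.injective h
    exact ⟨rfl, h'⟩
  · rintro ⟨rfl, h⟩
    exact ⟨rfl, h⟩

theorem isomorphic_rotate {V : Fin 3 → Type*} (H : ∀ i, Digraph (V i)) (c : Fin 3) :
    Isomorphic (comp cycle3 fun k => H (k + c)) (comp cycle3 H) :=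
  isomorphic_comp_reindex H (Equiv.addRight c) fun a b => by
    change b + c = a + c + 1 ↔ b = a + 1
    rw [add_right_comm, add_left_inj]

theorem isomorphic_rotate' {V : Fin 3 → Type*} (H : ∀ i, Digraph (V i)) (c : Fin 3) :
    Isomorphic (comp cycle3 H) (comp cycle3 fun k => H (k + c)) :=
  (isomorphic_rotate H c).elim fun e => ⟨e.symm⟩

/-- Parts of given orders can be labelled by `Fin n` in such a way that every part that has
arcs has the arc `0 1`. -/
theorem exists_labelling {ι : Type*} {V : ι → Type*} [∀ i, Fintype (V i)] (D : Digraph ι)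
    (H : ∀ i, Digraph (V i)) (hl : ∀ i, Loopless (H i)) (n : ι → ℕ) (hn : ∀ i, 2 ≤ n i)
    (hV : ∀ i, Fintype.card (V i) = n i) :
    ∃ E : ∀ i, Digraph (Fin (n i)), Isomorphic (comp D H) (comp D E) ∧ (∀ i, Loopless (E i)) ∧
      ∀ i x y, (E i).Adj x y →
        (E i).Adj ⟨0, by have := hn i; omega⟩ ⟨1, by have := hn i; omega⟩ := by
  have key : ∀ i, ∃ g : V i ≃ Fin (n i), ∀ x y, (H i).Adj x y →
      (H i).Adj (g.symm ⟨0, by have := hn i; omega⟩) (g.symm ⟨1, by have := hn i; omega⟩) := by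
    intro i
    have h2 := hn i
    let g := Fintype.equivFinOfCardEq (hV i)
    by_cases hex : ∃ x y, (H i).Adj x y
    · obtain ⟨x, y, hxy⟩ := hex
      have hne : x ≠ y := by rintro rfl; exact hl i x hxy
      let g₁ := g.trans (Equiv.swap (g x) ⟨0, by omega⟩)
      have h₁ : g₁ x = ⟨0, by omega⟩ := by simp [g₁]
      let g₂ := g₁.trans (Equiv.swap (g₁ y) ⟨1, by omega⟩)
      have h₂ : g₂ y = ⟨1, by omega⟩ := by simp [g₂]
      have h₃ : g₂ x = ⟨0, by omega⟩ := by
        simp only [g₂, Equiv.trans_apply, h₁]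
        refine Equiv.swap_apply_of_ne_of_ne ?_ (by simp)
        rw [← h₁]
        exact fun h => hne (g₁.injective h)
      refine ⟨g₂, fun _ _ _ => ?_⟩
      rwa [← h₂, ← h₃, Equiv.symm_apply_apply, Equiv.symm_apply_apply]
    · exact ⟨g, fun x y h => absurd ⟨x, y, h⟩ hex⟩
  choose g hg using key
  refine ⟨fun i => ⟨fun a b => (H i).Adj ((g i).symm a) ((g i).symm b)⟩,
    isomorphic_comp_parts D g fun i x y => by simp, fun i x => hl i _, fun i x y h => hg i _ _ h⟩

/-- Larger parts are mapped onto smaller arcless ones. -/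
theorem HasStrongPacking.comp_of_card_le {ι J : Type*} {V : ι → Type*} [∀ i, Fintype (V i)]
    {D : Digraph ι} [Nontrivial ι] (H : ∀ i, Digraph (V i)) (n : ι → ℕ) (hn : ∀ i, 0 < n i)
    (hV : ∀ i, n i ≤ Fintype.card (V i))
    (h : HasStrongPacking (StrongPacking.comp D fun i => arcless (n i)) J) :
    HasStrongPacking (StrongPacking.comp D H) J := by
  have hs : ∀ i, ∃ g : V i → Fin (n i), Function.Surjective g := fun i => by
    obtain ⟨e⟩ := Function.Embedding.nonempty_of_card_le (α := Fin (n i)) (β := V i)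
      (by simpa using hV i)
    have : Nonempty (Fin (n i)) := ⟨⟨0, hn i⟩⟩
    exact ⟨Function.invFun e, Function.invFun_surjective e.injective⟩
  choose g hg using hs
  have : Nontrivial (Σ i, Fin (n i)) := by
    obtain ⟨i, p, hip⟩ := exists_pair_ne ι
    exact ⟨⟨i, 0, hn i⟩, ⟨p, 0, hn p⟩, fun h => hip (congrArg Sigma.fst h)⟩
  refine h.pullback (Sigma.map id g) ?_ ?_
  · rintro ⟨i, a⟩
    obtain ⟨b, rfl⟩ := hg i a
    exact ⟨⟨i, b⟩, rfl⟩
  · rintro ⟨i, a⟩ ⟨p, b⟩ h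
    rcases Sigma.lex_iff.mp h with h' | ⟨_, h'⟩
    · exact Sigma.Lex.left _ _ h'
    · exact False.elim h'

/-! ### Compositions of the directed triangle into two strong spanning subgraphs -/

/-- Two arc-disjoint closed spanning walks, given by their cyclic sequences of vertices. -/
theorem hasStrongPacking_of_closedWalks {V : Type*} {Q : Digraph V} {m n : ℕ} [NeZero m]
    [NeZero n] (w : Fin m → V) (w' : Fin n → V) (hw : ∀ x, ∃ i, w i = x)
    (hw' : ∀ x, ∃ i, w' i = x) (hQ : ∀ i, Q.Adj (w i) (w (i + 1)))
    (hQ' : ∀ i, Q.Adj (w' i) (w' (i + 1)))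
    (hdis : ∀ i j, w i = w' j → w (i + 1) ≠ w' (j + 1)) : HasStrongPacking Q (Fin 2) := by
  have walk : ∀ {l : ℕ} [NeZero l] (u : Fin l → V), (∀ x, ∃ i, u i = x) → ∀ x y,
      ReflTransGen (fun x y => ∃ i, u i = x ∧ u (i + 1) = y) x y := by
    intro l _ u hu x y
    obtain ⟨i, rfl⟩ := hu x
    obtain ⟨j, rfl⟩ := hu y
    have h : ∀ k : ℕ, ReflTransGen (fun x y => ∃ i, u i = x ∧ u (i + 1) = y) (u i)
        (u (i + Fin.ofNat l k)) := by
      intro k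
      induction k with
      | zero => simpa using ReflTransGen.refl
      | succ k ih =>
        refine ih.tail ⟨_, rfl, ?_⟩
        congr 1
        rw [add_assoc]
        congr 1
        ext
        simp [Fin.val_add]
    have := h (j - i).val
    rwa [show Fin.ofNat l (j - i).val = j - i by simp, add_sub_cancel] at this
  refine ⟨![fun x y => ∃ i, w i = x ∧ w (i + 1) = y, fun x y => ∃ i, w' i = x ∧ w' (i + 1) = y],
    ?_, ?_, ?_⟩
  · intro j
    fin_cases j
    · rintro _ _ ⟨i, rfl, rfl⟩; exact hQ i
    · rintro _ _ ⟨i, rfl, rfl⟩; exact hQ' i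
  · intro i j
    fin_cases i <;> fin_cases j
    · exact fun _ _ _ _ => rfl
    · rintro _ _ ⟨i, rfl, rfl⟩ ⟨j, h, h'⟩; exact absurd h'.symm (hdis i j h.symm)
    · rintro _ _ ⟨i, rfl, rfl⟩ ⟨j, h, h'⟩; exact absurd h' (hdis j i h)
    · exact fun _ _ _ _ => rfl
  · intro j
    fin_cases j
    · exact walk w hw
    · exact walk w' hw'

/-- This and the following theorems treat the smallest non-exceptional compositions of the
directed triangle; larger parts and further arcs are reduced to them. A vertex is written as the
pair of its part and its number within the part. -/
theorem hasStrongPacking_cycle3_two_cycle (E : Fin 3 → Digraph (Fin 2))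
    (h0 : (E 0).Adj (0 : Fin 2) (1 : Fin 2)) (h1 : (E 0).Adj (1 : Fin 2) (0 : Fin 2)) :
    HasStrongPacking (comp cycle3 E) (Fin 2) := by
  let w : Fin 6 → Σ _ : Fin 3, Fin 2 :=
      ![⟨0, (0 : Fin 2)⟩, ⟨1, (1 : Fin 2)⟩, ⟨2, (0 : Fin 2)⟩, ⟨0, (1 : Fin 2)⟩, ⟨1, (0 : Fin 2)⟩,
        ⟨2, (1 : Fin 2)⟩]
  let w' : Fin 8 → Σ _ : Fin 3, Fin 2 :=
      ![⟨0, (0 : Fin 2)⟩, ⟨1, (0 : Fin 2)⟩, ⟨2, (0 : Fin 2)⟩, ⟨0, (0 : Fin 2)⟩, ⟨0, (1 : Fin 2)⟩,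
        ⟨1, (1 : Fin 2)⟩, ⟨2, (1 : Fin 2)⟩, ⟨0, (1 : Fin 2)⟩]
  refine hasStrongPacking_of_closedWalks w w' (by decide) (by decide) ?_ ?_ (by decide)
  · have h : ∀ i, (w (i + 1)).1 = (w i).1 + 1 := by decide
    exact fun i => Sigma.Lex.left _ _ (h i)
  · have h : ∀ i, (w' (i + 1)).1 = (w' i).1 + 1 ∨
        w' i = ⟨0, (0 : Fin 2)⟩ ∧ w' (i + 1) = ⟨0, (1 : Fin 2)⟩ ∨
        w' i = ⟨0, (1 : Fin 2)⟩ ∧ w' (i + 1) = ⟨0, (0 : Fin 2)⟩ := by decide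
    intro i
    rcases h i with h | ⟨h, h'⟩ | ⟨h, h'⟩
    · exact Sigma.Lex.left _ _ h
    · rw [h, h']; exact Sigma.Lex.right _ _ h0
    · rw [h, h']; exact Sigma.Lex.right _ _ h1

theorem hasStrongPacking_cycle3_two_paths (E : Fin 3 → Digraph (Fin 2))
    (h0 : (E 0).Adj (0 : Fin 2) (1 : Fin 2)) (h1 : (E 1).Adj (0 : Fin 2) (1 : Fin 2)) :
    HasStrongPacking (comp cycle3 E) (Fin 2) := by
  let w : Fin 6 → Σ _ : Fin 3, Fin 2 :=
      ![⟨0, (0 : Fin 2)⟩, ⟨1, (0 : Fin 2)⟩, ⟨2, (0 : Fin 2)⟩, ⟨0, (1 : Fin 2)⟩, ⟨1, (1 : Fin 2)⟩,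
        ⟨2, (1 : Fin 2)⟩]
  let w' : Fin 8 → Σ _ : Fin 3, Fin 2 :=
      ![⟨0, (0 : Fin 2)⟩, ⟨0, (1 : Fin 2)⟩, ⟨1, (0 : Fin 2)⟩, ⟨2, (1 : Fin 2)⟩, ⟨0, (1 : Fin 2)⟩,
        ⟨1, (0 : Fin 2)⟩, ⟨1, (1 : Fin 2)⟩, ⟨2, (0 : Fin 2)⟩]
  refine hasStrongPacking_of_closedWalks w w' (by decide) (by decide) ?_ ?_ (by decide)
  · have h : ∀ i, (w (i + 1)).1 = (w i).1 + 1 := by decide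
    exact fun i => Sigma.Lex.left _ _ (h i)
  · have h : ∀ i, (w' (i + 1)).1 = (w' i).1 + 1 ∨
        w' i = ⟨0, (0 : Fin 2)⟩ ∧ w' (i + 1) = ⟨0, (1 : Fin 2)⟩ ∨
        w' i = ⟨1, (0 : Fin 2)⟩ ∧ w' (i + 1) = ⟨1, (1 : Fin 2)⟩ := by decide
    intro i
    rcases h i with h | ⟨h, h'⟩ | ⟨h, h'⟩
    · exact Sigma.Lex.left _ _ h
    · rw [h, h']; exact Sigma.Lex.right _ _ h0
    · rw [h, h']; exact Sigma.Lex.right _ _ h1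

theorem hasStrongPacking_cycle3_arc_zero (E : ∀ i : Fin 3, Digraph (Fin (![2, 2, 3] i)))
    (h0 : (E 0).Adj (0 : Fin 2) (1 : Fin 2)) :
    HasStrongPacking (comp cycle3 E) (Fin 2) := by
  let w : Fin 9 → Σ i : Fin 3, Fin (![2, 2, 3] i) :=
      ![⟨0, (0 : Fin 2)⟩, ⟨1, (1 : Fin 2)⟩, ⟨2, (0 : Fin 3)⟩, ⟨0, (1 : Fin 2)⟩, ⟨1, (0 : Fin 2)⟩,
        ⟨2, (1 : Fin 3)⟩, ⟨0, (1 : Fin 2)⟩, ⟨1, (0 : Fin 2)⟩, ⟨2, (2 : Fin 3)⟩]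
  let w' : Fin 10 → Σ i : Fin 3, Fin (![2, 2, 3] i) :=
      ![⟨0, (0 : Fin 2)⟩, ⟨1, (0 : Fin 2)⟩, ⟨2, (0 : Fin 3)⟩, ⟨0, (0 : Fin 2)⟩, ⟨0, (1 : Fin 2)⟩,
        ⟨1, (1 : Fin 2)⟩, ⟨2, (2 : Fin 3)⟩, ⟨0, (1 : Fin 2)⟩, ⟨1, (1 : Fin 2)⟩, ⟨2, (1 : Fin 3)⟩]
  refine hasStrongPacking_of_closedWalks w w' (by decide) (by decide) ?_ ?_ (by decide)
  · have h : ∀ i, (w (i + 1)).1 = (w i).1 + 1 := by decide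
    exact fun i => Sigma.Lex.left _ _ (h i)
  · have h : ∀ i, (w' (i + 1)).1 = (w' i).1 + 1 ∨
        w' i = ⟨0, (0 : Fin 2)⟩ ∧ w' (i + 1) = ⟨0, (1 : Fin 2)⟩ := by decide
    intro i
    rcases h i with h | ⟨h, h'⟩
    · exact Sigma.Lex.left _ _ h
    · rw [h, h']; exact Sigma.Lex.right _ _ h0

theorem hasStrongPacking_cycle3_arc_one (E : ∀ i : Fin 3, Digraph (Fin (![2, 2, 3] i)))
    (h0 : (E 1).Adj (0 : Fin 2) (1 : Fin 2)) :
    HasStrongPacking (comp cycle3 E) (Fin 2) := by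
  let w : Fin 9 → Σ i : Fin 3, Fin (![2, 2, 3] i) :=
      ![⟨0, (0 : Fin 2)⟩, ⟨1, (0 : Fin 2)⟩, ⟨2, (2 : Fin 3)⟩, ⟨0, (0 : Fin 2)⟩, ⟨1, (0 : Fin 2)⟩,
        ⟨2, (0 : Fin 3)⟩, ⟨0, (1 : Fin 2)⟩, ⟨1, (1 : Fin 2)⟩, ⟨2, (1 : Fin 3)⟩]
  let w' : Fin 10 → Σ i : Fin 3, Fin (![2, 2, 3] i) :=
      ![⟨0, (0 : Fin 2)⟩, ⟨1, (1 : Fin 2)⟩, ⟨2, (2 : Fin 3)⟩, ⟨0, (1 : Fin 2)⟩, ⟨1, (0 : Fin 2)⟩,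
        ⟨2, (1 : Fin 3)⟩, ⟨0, (1 : Fin 2)⟩, ⟨1, (0 : Fin 2)⟩, ⟨1, (1 : Fin 2)⟩, ⟨2, (0 : Fin 3)⟩]
  refine hasStrongPacking_of_closedWalks w w' (by decide) (by decide) ?_ ?_ (by decide)
  · have h : ∀ i, (w (i + 1)).1 = (w i).1 + 1 := by decide
    exact fun i => Sigma.Lex.left _ _ (h i)
  · have h : ∀ i, (w' (i + 1)).1 = (w' i).1 + 1 ∨
        w' i = ⟨1, (0 : Fin 2)⟩ ∧ w' (i + 1) = ⟨1, (1 : Fin 2)⟩ := by decide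
    intro i
    rcases h i with h | ⟨h, h'⟩
    · exact Sigma.Lex.left _ _ h
    · rw [h, h']; exact Sigma.Lex.right _ _ h0

theorem hasStrongPacking_cycle3_arc_two (E : ∀ i : Fin 3, Digraph (Fin (![2, 2, 3] i)))
    (h0 : (E 2).Adj (0 : Fin 3) (1 : Fin 3)) :
    HasStrongPacking (comp cycle3 E) (Fin 2) := by
  let w : Fin 9 → Σ i : Fin 3, Fin (![2, 2, 3] i) :=
      ![⟨0, (0 : Fin 2)⟩, ⟨1, (0 : Fin 2)⟩, ⟨2, (1 : Fin 3)⟩, ⟨0, (1 : Fin 2)⟩, ⟨1, (1 : Fin 2)⟩,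
        ⟨2, (0 : Fin 3)⟩, ⟨0, (0 : Fin 2)⟩, ⟨1, (0 : Fin 2)⟩, ⟨2, (2 : Fin 3)⟩]
  let w' : Fin 7 → Σ i : Fin 3, Fin (![2, 2, 3] i) :=
      ![⟨0, (0 : Fin 2)⟩, ⟨1, (1 : Fin 2)⟩, ⟨2, (2 : Fin 3)⟩, ⟨0, (1 : Fin 2)⟩, ⟨1, (0 : Fin 2)⟩,
        ⟨2, (0 : Fin 3)⟩, ⟨2, (1 : Fin 3)⟩]
  refine hasStrongPacking_of_closedWalks w w' (by decide) (by decide) ?_ ?_ (by decide)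
  · have h : ∀ i, (w (i + 1)).1 = (w i).1 + 1 := by decide
    exact fun i => Sigma.Lex.left _ _ (h i)
  · have h : ∀ i, (w' (i + 1)).1 = (w' i).1 + 1 ∨
        w' i = ⟨2, (0 : Fin 3)⟩ ∧ w' (i + 1) = ⟨2, (1 : Fin 3)⟩ := by decide
    intro i
    rcases h i with h | ⟨h, h'⟩
    · exact Sigma.Lex.left _ _ h
    · rw [h, h']; exact Sigma.Lex.right _ _ h0

theorem hasStrongPacking_cycle3_two_two_four (E : ∀ i : Fin 3, Digraph (Fin (![2, 2, 4] i))) :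
    HasStrongPacking (comp cycle3 E) (Fin 2) := by
  let w : Fin 12 → Σ i : Fin 3, Fin (![2, 2, 4] i) :=
      ![⟨0, (0 : Fin 2)⟩, ⟨1, (0 : Fin 2)⟩, ⟨2, (0 : Fin 4)⟩, ⟨0, (1 : Fin 2)⟩, ⟨1, (1 : Fin 2)⟩,
        ⟨2, (1 : Fin 4)⟩, ⟨0, (1 : Fin 2)⟩, ⟨1, (1 : Fin 2)⟩, ⟨2, (2 : Fin 4)⟩, ⟨0, (0 : Fin 2)⟩,
        ⟨1, (0 : Fin 2)⟩, ⟨2, (3 : Fin 4)⟩]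
  let w' : Fin 12 → Σ i : Fin 3, Fin (![2, 2, 4] i) :=
      ![⟨0, (0 : Fin 2)⟩, ⟨1, (1 : Fin 2)⟩, ⟨2, (0 : Fin 4)⟩, ⟨0, (0 : Fin 2)⟩, ⟨1, (1 : Fin 2)⟩,
        ⟨2, (3 : Fin 4)⟩, ⟨0, (1 : Fin 2)⟩, ⟨1, (0 : Fin 2)⟩, ⟨2, (2 : Fin 4)⟩, ⟨0, (1 : Fin 2)⟩,
        ⟨1, (0 : Fin 2)⟩, ⟨2, (1 : Fin 4)⟩]
  refine hasStrongPacking_of_closedWalks w w' (by decide) (by decide) ?_ ?_ (by decide)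
  · have h : ∀ i, (w (i + 1)).1 = (w i).1 + 1 := by decide
    exact fun i => Sigma.Lex.left _ _ (h i)
  · have h : ∀ i, (w' (i + 1)).1 = (w' i).1 + 1 := by decide
    exact fun i => Sigma.Lex.left _ _ (h i)

theorem hasStrongPacking_cycle3_two_three_three (E : ∀ i : Fin 3, Digraph (Fin (![2, 3, 3] i))) :
    HasStrongPacking (comp cycle3 E) (Fin 2) := by
  let w : Fin 9 → Σ i : Fin 3, Fin (![2, 3, 3] i) :=
      ![⟨0, (0 : Fin 2)⟩, ⟨1, (2 : Fin 3)⟩, ⟨2, (1 : Fin 3)⟩, ⟨0, (1 : Fin 2)⟩, ⟨1, (0 : Fin 3)⟩,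
        ⟨2, (0 : Fin 3)⟩, ⟨0, (1 : Fin 2)⟩, ⟨1, (1 : Fin 3)⟩, ⟨2, (2 : Fin 3)⟩]
  let w' : Fin 9 → Σ i : Fin 3, Fin (![2, 3, 3] i) :=
      ![⟨0, (0 : Fin 2)⟩, ⟨1, (0 : Fin 3)⟩, ⟨2, (2 : Fin 3)⟩, ⟨0, (1 : Fin 2)⟩, ⟨1, (2 : Fin 3)⟩,
        ⟨2, (0 : Fin 3)⟩, ⟨0, (0 : Fin 2)⟩, ⟨1, (1 : Fin 3)⟩, ⟨2, (1 : Fin 3)⟩]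
  refine hasStrongPacking_of_closedWalks w w' (by decide) (by decide) ?_ ?_ (by decide)
  · have h : ∀ i, (w (i + 1)).1 = (w i).1 + 1 := by decide
    exact fun i => Sigma.Lex.left _ _ (h i)
  · have h : ∀ i, (w' (i + 1)).1 = (w' i).1 + 1 := by decide
    exact fun i => Sigma.Lex.left _ _ (h i)

theorem hasStrongPacking_cycle3_three_two_three (E : ∀ i : Fin 3, Digraph (Fin (![3, 2, 3] i))) :
    HasStrongPacking (comp cycle3 E) (Fin 2) := by
  let w : Fin 9 → Σ i : Fin 3, Fin (![3, 2, 3] i) :=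
      ![⟨0, (0 : Fin 3)⟩, ⟨1, (0 : Fin 2)⟩, ⟨2, (2 : Fin 3)⟩, ⟨0, (1 : Fin 3)⟩, ⟨1, (1 : Fin 2)⟩,
        ⟨2, (1 : Fin 3)⟩, ⟨0, (2 : Fin 3)⟩, ⟨1, (0 : Fin 2)⟩, ⟨2, (0 : Fin 3)⟩]
  let w' : Fin 9 → Σ i : Fin 3, Fin (![3, 2, 3] i) :=
      ![⟨0, (0 : Fin 3)⟩, ⟨1, (1 : Fin 2)⟩, ⟨2, (2 : Fin 3)⟩, ⟨0, (2 : Fin 3)⟩, ⟨1, (1 : Fin 2)⟩,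
        ⟨2, (0 : Fin 3)⟩, ⟨0, (1 : Fin 3)⟩, ⟨1, (0 : Fin 2)⟩, ⟨2, (1 : Fin 3)⟩]
  refine hasStrongPacking_of_closedWalks w w' (by decide) (by decide) ?_ ?_ (by decide)
  · have h : ∀ i, (w (i + 1)).1 = (w i).1 + 1 := by decide
    exact fun i => Sigma.Lex.left _ _ (h i)
  · have h : ∀ i, (w' (i + 1)).1 = (w' i).1 + 1 := by decide
    exact fun i => Sigma.Lex.left _ _ (h i)

/-- Apart from the exceptional digraphs, a part contains a 2-cycle or two consecutive parts
contain arcs; any two of the three parts are consecutive in the triangle. -/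
theorem hasStrongPacking_cycle3_of_card_two (E : Fin 3 → Digraph (Fin 2))
    (hl : ∀ i, Loopless (E i)) (h01 : ∀ i x y, (E i).Adj x y → (E i).Adj 0 1)
    (hexc : ¬ IsExceptional (comp cycle3 E)) : HasStrongPacking (comp cycle3 E) (Fin 2) := by
  by_contra hno
  have hno' : ∀ c, ¬ HasStrongPacking (comp cycle3 fun k => E (k + c)) (Fin 2) := fun c h =>
    hno (h.of_isomorphic (isomorphic_rotate' E c))
  have hcyc : ∀ i, (E i).Adj 0 1 → ¬ (E i).Adj 1 0 := fun i h h' =>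
    hno' i (hasStrongPacking_cycle3_two_cycle (fun k => E (k + i)) (by simpa using h)
      (by simpa using h'))
  have hpath : ∀ i, (E i).Adj 0 1 → ¬ (E (i + 1)).Adj 0 1 := fun i h h' =>
    hno' i (hasStrongPacking_cycle3_two_paths (fun k => E (k + i)) (by simpa using h)
      (by simpa [add_comm] using h'))
  apply hexc
  by_cases hex : ∃ i, (E i).Adj 0 1
  · obtain ⟨i, hi⟩ := hex
    have h1 : ∀ x y, ¬ (E (1 + i)).Adj x y := fun x y h => by
      rw [add_comm] at h
      exact hpath i hi (h01 _ x y h)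
    have h2 : ∀ x y, ¬ (E (2 + i)).Adj x y := fun x y h => by
      refine hpath (2 + i) (h01 _ x y h) ?_
      have : 2 + i + 1 = i := by fin_cases i <;> rfl
      rwa [this]
    refine (isomorphic_rotate' E i).isExceptional (Or.inr (Or.inl ?_))
    refine isomorphic_comp_parts cycle3 (fun _ => Equiv.refl _) fun k x y => ?_
    fin_cases k
    · have h0 : (E (0 + i)).Adj x y ↔ x = 0 ∧ y = 1 := by
        rw [zero_add]
        refine ⟨fun h => ?_, by rintro ⟨rfl, rfl⟩; exact hi⟩
        fin_cases x <;> fin_cases y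
        · exact absurd h (hl i 0)
        · exact ⟨rfl, rfl⟩
        · exact absurd h (hcyc i hi)
        · exact absurd h (hl i 1)
      exact h0.symm
    · exact iff_of_false id (h1 x y)
    · exact iff_of_false id (h2 x y)
  · exact Or.inl (isomorphic_comp_parts cycle3 (fun _ => Equiv.refl _) fun k x y =>
      iff_of_false id fun h => hex ⟨k, h01 k x y h⟩)

theorem hasStrongPacking_cycle3_of_card_two_two_three
    (E : ∀ i : Fin 3, Digraph (Fin (![2, 2, 3] i)))
    (h01 : ∀ i x y, (E i).Adj x y →
      (E i).Adj ⟨0, by fin_cases i <;> decide⟩ ⟨1, by fin_cases i <;> decide⟩)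
    (hexc : ¬ IsExceptional (comp cycle3 E)) : HasStrongPacking (comp cycle3 E) (Fin 2) := by
  by_contra hno
  refine hexc (Or.inr (Or.inr (isomorphic_comp_parts cycle3 (fun _ => Equiv.refl _)
    fun k x y => iff_of_false id fun h => hno ?_)))
  have h := h01 k x y h
  fin_cases k
  · exact hasStrongPacking_cycle3_arc_zero E h
  · exact hasStrongPacking_cycle3_arc_one E h
  · exact hasStrongPacking_cycle3_arc_two E h

/-- The case of the directed triangle and two subgraphs, where the arcs inside the parts and the
exact orders of the parts matter. -/
theorem hasStrongPacking_cycle3_two {V : Fin 3 → Type*} [∀ i, Fintype (V i)]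
    (H : ∀ i, Digraph (V i)) (hl : ∀ i, Loopless (H i)) (hV : ∀ i, 2 ≤ Fintype.card (V i))
    (hexc : ¬ IsExceptional (comp cycle3 H)) : HasStrongPacking (comp cycle3 H) (Fin 2) := by
  -- rotate a part of maximal order to position `2`
  suffices key : ∀ (V : Fin 3 → Type _) [∀ i, Fintype (V i)] (H : ∀ i, Digraph (V i)),
      (∀ i, Loopless (H i)) → (∀ i, 2 ≤ Fintype.card (V i)) →
      (∀ i, Fintype.card (V i) ≤ Fintype.card (V 2)) → ¬ IsExceptional (comp cycle3 H) →
      HasStrongPacking (comp cycle3 H) (Fin 2) by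
    obtain ⟨c, hc⟩ := Finite.exists_max fun i => Fintype.card (V i)
    refine (key (fun k => V (k + (c + 1))) (fun k => H (k + (c + 1))) (fun k => hl _)
      (fun k => hV _) (fun k => ?_) fun h => hexc ((isomorphic_rotate' H _).isExceptional h)
      ).of_isomorphic (isomorphic_rotate' H (c + 1))
    have : 2 + (c + 1) = c := by fin_cases c <;> rfl
    rw [this]
    exact hc _
  intro V _ H hl hV hmax hexc
  have h0 := hV 0
  have h1 := hV 1
  have h0' := hmax 0
  have h1' := hmax 1
  rcases lt_trichotomy (Fintype.card (V 2)) 3 with h2 | h2 | h2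
  · obtain ⟨E, hE, hEl, h01⟩ := exists_labelling cycle3 H hl (fun _ => 2) (fun _ => le_rfl)
      fun i => le_antisymm ((hmax i).trans (by omega)) (hV i)
    exact (hasStrongPacking_cycle3_of_card_two E hEl h01
      fun h => hexc (hE.isExceptional h)).of_isomorphic hE
  · by_cases h03 : Fintype.card (V 0) = 3
    · refine HasStrongPacking.comp_of_card_le H ![3, 2, 3] (by decide) ?_
        (hasStrongPacking_cycle3_three_two_three _)
      intro i
      fin_cases i
      exacts [h03.ge, h1, h2.ge]
    by_cases h13 : Fintype.card (V 1) = 3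
    · refine HasStrongPacking.comp_of_card_le H ![2, 3, 3] (by decide) ?_
        (hasStrongPacking_cycle3_two_three_three _)
      intro i
      fin_cases i
      exacts [h0, h13.ge, h2.ge]
    obtain ⟨E, hE, -, h01⟩ := exists_labelling cycle3 H hl ![2, 2, 3] (by decide) (by
      intro i
      fin_cases i
      · change Fintype.card (V 0) = 2; omega
      · change Fintype.card (V 1) = 2; omega
      · exact h2)
    exact (hasStrongPacking_cycle3_of_card_two_two_three E h01
      fun h => hexc (hE.isExceptional h)).of_isomorphic hE
  · refine HasStrongPacking.comp_of_card_le H ![2, 2, 4] (by decide) ?_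
      (hasStrongPacking_cycle3_two_two_four _)
    intro i
    fin_cases i
    exacts [h0, h1, h2]

/-! ### The lower bound and its sharpness -/

lemma minOrder_le {ι : Type*} (V : ι → Type*) [∀ i, Fintype (V i)] (i : ι) :
    minOrder V ≤ Fintype.card (V i) :=
  ciInf_le (OrderBot.bddBelow _) i

lemma minOrder_const {ι : Type*} [Nonempty ι] (r : ℕ) : minOrder (fun _ : ι => Fin r) = r := by
  simp [minOrder]

theorem IsStrong.exists_digon {ι : Type*} [Nontrivial ι] {D : Digraph ι} (hD : IsStrong D)
    (hs : IsSymmetric D) : ∃ x y, D.Adj x y ∧ D.Adj y x := by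
  obtain ⟨v, w, hvw⟩ := exists_pair_ne ι
  obtain ⟨x, hx⟩ := exists_step (hD v w) hvw
  exact ⟨v, x, hx, hs _ _ hx⟩

lemma three_cycle_injective {ι : Type*} {D : Digraph ι} (hl : Loopless D)
    {f : Fin 3 → ι} (hf : ∀ i, D.Adj (f i) (f (i + 1))) : Function.Injective f := by
  have h1 : ∀ i, f i ≠ f (i + 1) := fun i h => hl (f (i + 1)) (h ▸ hf i)
  intro i j h
  by_contra hij
  have : j = i + 1 ∨ i = j + 1 := by fin_cases i <;> fin_cases j <;> simp at hij ⊢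
  rcases this with rfl | rfl
  · exact h1 i h
  · exact h1 j h.symm

lemma four_cycle_injective {ι : Type*} {D : Digraph ι} (hl : Loopless D)
    (h2 : ∀ x y, D.Adj x y → ¬ D.Adj y x) {f : Fin 4 → ι} (hf : ∀ i, D.Adj (f i) (f (i + 1))) :
    Function.Injective f := by
  have h1 : ∀ i, f i ≠ f (i + 1) := fun i h => hl (f (i + 1)) (h ▸ hf i)
  have h3 : ∀ i, f i ≠ f (i + 2) := fun i h => by
    have h4 := hf (i + 1)
    have h5 : i + 1 + 1 = i + 2 := by fin_cases i <;> rfl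
    rw [h5, ← h] at h4
    exact h2 _ _ (hf i) h4
  intro i j h
  by_contra hij
  have : j = i + 1 ∨ i = j + 1 ∨ j = i + 2 := by
    fin_cases i <;> fin_cases j <;> simp at hij ⊢
  rcases this with rfl | rfl | rfl
  · exact h1 i h
  · exact h1 j h.symm
  · exact h3 i h

lemma cycle_adj {ι : Type*} {D : Digraph ι} {n : ℕ} [NeZero n] {f : Fin n → ι}
    (hf : ∀ i, D.Adj (f i) (f (i + 1))) (a b : Fin n) (h : (cycleDigraph n).Adj a b) :
    D.Adj (f a) (f b) := by
  obtain rfl : b = a + 1 := h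
  exact hf a

theorem hasStrongPacking_blowUp_of_digon {ι : Type*} {D : Digraph ι} (hl : Loopless D)
    (hD : IsStrong D) {x y : ι} (hxy : D.Adj x y) (hyx : D.Adj y x) (r : ℕ) [NeZero r] :
    HasStrongPacking (blowUp D (ZMod r)) (ZMod r) := by
  have hne : x ≠ y := by rintro rfl; exact hl _ hxy
  refine (hasStrongPacking_blowUp_cycle_two r).extend hD ![x, y] ?_ (cycle_adj ?_)
  · intro i j
    fin_cases i <;> fin_cases j <;> simp [hne, hne.symm]
  · intro i
    fin_cases i
    exacts [hxy, hyx]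

/-- A strong tournament of order three is the directed triangle. -/
theorem exists_equiv_cycle3 {ι : Type*} [Fintype ι] (hc : Fintype.card ι = 3) {D : Digraph ι}
    (hl : Loopless D) (h2 : ∀ x y, D.Adj x y → ¬ D.Adj y x) {f : Fin 3 → ι}
    (hf : ∀ i, D.Adj (f i) (f (i + 1))) :
    ∃ e : Fin 3 ≃ ι, ∀ a b, D.Adj (e a) (e b) ↔ cycle3.Adj a b := by
  have hb : Function.Bijective f := (Fintype.bijective_iff_injective_and_card f).mpr
    ⟨three_cycle_injective hl hf, by simp [hc]⟩
  refine ⟨Equiv.ofBijective f hb, fun a b => ⟨fun h => ?_, cycle_adj hf a b⟩⟩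
  change D.Adj (f a) (f b) at h
  have : b = a + 1 ∨ a = b + 1 ∨ a = b := by fin_cases a <;> fin_cases b <;> simp
  rcases this with h' | rfl | rfl
  · exact h'
  · exact absurd h (h2 _ _ (hf b))
  · exact absurd h (hl _)

/-- The bound for a strong tournament `D`: with `r` the least order of a part, a directed triangle
of `D` serves if `r ≠ 2`, and a directed 4-cycle if `r = 2` and `D` has at least four vertices. -/
theorem minOrder_le_lambda_of_tournament {ι : Type*} [Fintype ι] {V : ι → Type*}
    [∀ i, Fintype (V i)] {D : Digraph ι} (H : ∀ i, Digraph (V i)) [Nontrivial ι]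
    (hl : Loopless D) (hH : ∀ i, Loopless (H i)) (hD : IsStrong D) (hs : IsSemicomplete D)
    (h2 : ∀ x y, D.Adj x y → ¬ D.Adj y x) (hexc : ¬ IsExceptional (comp D H)) {k : ℕ}
    (hk : 2 ≤ k) : (minOrder V : ℕ∞) ≤ lambda (comp D H) k := by
  obtain ⟨f, hf⟩ := exists_triangle hl hD hs h2
  have hfi := three_cycle_injective hl hf
  rcases Nat.eq_zero_or_pos (minOrder V) with h0 | h0
  · simp [h0]
  have : NeZero (minOrder V) := ⟨h0.ne'⟩
  have hcomp : HasStrongPacking (blowUp D (ZMod (minOrder V))) (ZMod (minOrder V)) →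
      (minOrder V : ℕ∞) ≤ lambda (comp D H) k := fun h => by
    have := (h.comp H fun i => by rw [ZMod.card]; exact minOrder_le V i).card_le_lambda hk
    rwa [ZMod.card] at this
  by_cases hr : minOrder V = 2
  · rcases lt_or_ge (Fintype.card ι) 4 with h4 | h4
    · have h3 : Fintype.card ι = 3 := by
        have := Fintype.card_le_of_injective f hfi
        simp at this
        omega
      obtain ⟨e, he⟩ := exists_equiv_cycle3 h3 hl h2 hf
      have hiso := isomorphic_comp_reindex H e he
      have hiso' : Isomorphic (comp D H) (comp cycle3 fun k => H (e k)) :=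
        hiso.elim fun g => ⟨g.symm⟩
      have := ((hasStrongPacking_cycle3_two (fun k => H (e k)) (fun k => hH _)
        (fun k => hr ▸ minOrder_le V (e k)) fun h => hexc (hiso'.isExceptional h)
        ).of_isomorphic hiso').card_le_lambda hk
      rwa [hr]
    · obtain ⟨g, hg⟩ := exists_fourCycle h4 hl hD hs h2
      exact hcomp ((hasStrongPacking_blowUp_cycle_four _).extend hD g
        (four_cycle_injective hl h2 hg) (cycle_adj hg))
  · exact hcomp ((hasStrongPacking_blowUp_cycle_three _ hr).extend hD f hfi (cycle_adj hf))

theorem minOrder_le_lambda_of_digon {ι : Type*} {V : ι → Type*} [∀ i, Fintype (V i)]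
    {D : Digraph ι} (H : ∀ i, Digraph (V i)) [Nontrivial ι] (hl : Loopless D) (hD : IsStrong D)
    {x y : ι} (hxy : D.Adj x y) (hyx : D.Adj y x) {k : ℕ} (hk : 2 ≤ k) :
    (minOrder V : ℕ∞) ≤ lambda (comp D H) k := by
  rcases Nat.eq_zero_or_pos (minOrder V) with h0 | h0
  · simp [h0]
  have : NeZero (minOrder V) := ⟨h0.ne'⟩
  have := ((hasStrongPacking_blowUp_of_digon hl hD hxy hyx (minOrder V)).comp H
    fun i => by rw [ZMod.card]; exact minOrder_le V i).card_le_lambda hk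
  rwa [ZMod.card] at this

/-- A vertex of out-degree `1` in `D` yields vertices of out-degree `r` in the composition. -/
theorem lambda_comp_arcless_le {ι : Type*} [Fintype ι] {D : Digraph ι} {v w : ι}
    (hv : ∀ x, D.Adj v x → x = w) {r : ℕ} (hr : 0 < r) {k : ℕ} (hk : 2 ≤ k)
    (hkV : k ≤ Fintype.card (Σ _ : ι, Fin r)) :
    lambda (comp D fun _ => arcless r) k ≤ r := by
  refine (lambda_le_outDegree _ ⟨v, ⟨0, hr⟩⟩ hk hkV).trans ?_
  have hsub : {y | (comp D fun _ => arcless r).Adj ⟨v, ⟨0, hr⟩⟩ y} ⊆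
      Set.range fun a : Fin r => (⟨w, a⟩ : Σ _ : ι, Fin r) := by
    rintro ⟨x, a⟩ h
    rcases Sigma.lex_iff.mp h with h' | ⟨_, h'⟩
    · exact ⟨a, by rw [hv x h']⟩
    · exact False.elim h'
  refine (Set.encard_le_encard hsub).trans ?_
  rw [← Set.image_univ]
  refine (Set.encard_image_le _ _).trans ?_
  simp

lemma exists_outDegree_one {ι : Type*} [Nonempty ι] {D : Digraph ι} (hs : IsSymmetric D)
    (h : minSemidegree D = 1) : ∃ v w, ∀ x, D.Adj v x → x = w := by
  have hsym : ∀ v w, D.Adj w v ↔ D.Adj v w := fun v w => ⟨hs _ _, hs _ _⟩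
  have h' : ⨅ v, {w | D.Adj v w}.ncard = 1 := by
    simpa [minSemidegree, hsym] using h
  obtain ⟨v, hv⟩ := ciInf_mem fun v => {w | D.Adj v w}.ncard
  rw [h'] at hv
  obtain ⟨w, hw⟩ := Set.ncard_eq_one.mp hv
  exact ⟨v, w, fun x hx => by simpa using hw.subset hx⟩

/-- The star, as a symmetric digraph. -/
def starDigraph (t : ℕ) : Digraph (Fin (t + 2)) where
  Adj i j := (i = 0 ∧ j ≠ 0) ∨ (i ≠ 0 ∧ j = 0)

lemma isSymmetric_star (t : ℕ) : IsSymmetric (starDigraph t) := fun _ _ h =>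
  h.symm.imp And.symm And.symm

lemma loopless_star (t : ℕ) : Loopless (starDigraph t) := by
  rintro v (⟨h, h'⟩ | ⟨h, h'⟩)
  exacts [h' h, h h']

lemma isStrong_star (t : ℕ) : IsStrong (starDigraph t) := by
  have h0 : ∀ x, ReflTransGen (starDigraph t).Adj 0 x := fun x => by
    by_cases hx : x = 0
    · rw [hx]
    · exact ReflTransGen.single (Or.inl ⟨rfl, hx⟩)
  have h1 : ∀ x, ReflTransGen (starDigraph t).Adj x 0 := fun x => by
    by_cases hx : x = 0
    · rw [hx]
    · exact ReflTransGen.single (Or.inr ⟨hx, rfl⟩)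
  exact fun x y => (h1 x).trans (h0 y)

lemma minSemidegree_star (t : ℕ) : minSemidegree (starDigraph t) = 1 := by
  have hsym : ∀ v w, (starDigraph t).Adj w v ↔ (starDigraph t).Adj v w := fun v w =>
    ⟨isSymmetric_star t _ _, isSymmetric_star t _ _⟩
  have h1 : ({w | (starDigraph t).Adj 1 w} : Set (Fin (t + 2))).ncard = 1 := by
    rw [Set.ncard_eq_one]
    exact ⟨0, by ext w; simp [starDigraph]⟩
  have h : ⨅ v, {w | (starDigraph t).Adj v w}.ncard = 1 := by
    refine le_antisymm (h1 ▸ ciInf_le (OrderBot.bddBelow _) (1 : Fin (t + 2))) ?_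
    refine le_ciInf fun v => (Set.ncard_pos (Set.toFinite _)).mpr ?_
    by_cases hv : v = 0
    · exact ⟨1, Or.inl ⟨hv, by simp⟩⟩
    · exact ⟨0, Or.inr ⟨hv, rfl⟩⟩
  simp [minSemidegree, hsym, h]

lemma loopless_cycle3 : Loopless cycle3 := by
  intro v h
  change v = v + 1 at h
  fin_cases v <;> simp at h

lemma isStrong_cycle3 : IsStrong cycle3 := by
  intro x y
  have h : ∀ a, ReflTransGen cycle3.Adj a (a + 1) := fun a => ReflTransGen.single rfl
  have : y = x ∨ y = x + 1 ∨ y = x + 1 + 1 := by fin_cases x <;> fin_cases y <;> simp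
  rcases this with rfl | rfl | rfl
  exacts [ReflTransGen.refl, h _, (h _).trans (h _)]

lemma isSemicomplete_cycle3 : IsSemicomplete cycle3 := by
  intro x y hxy
  change y = x + 1 ∨ x = y + 1
  fin_cases x <;> fin_cases y <;> simp at hxy ⊢

lemma cycle3_adj_asymm : ∀ x y, cycle3.Adj x y → ¬ cycle3.Adj y x := by
  intro x y h h'
  change y = x + 1 at h
  change x = y + 1 at h'
  fin_cases x <;> fin_cases y <;> simp at h h'

lemma not_isExceptional_of_three_le {r : ℕ} (hr : 3 ≤ r) :
    ¬ IsExceptional (comp cycle3 fun _ => arcless r) := by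
  rintro (⟨⟨e⟩⟩ | ⟨⟨e⟩⟩ | ⟨⟨e⟩⟩) <;>
  · have := Fintype.card_congr e.toEquiv
    simp [Fin.sum_univ_three] at this
    omega

end StrongPacking

theorem corollary4p7 :
    -- the bound, under either hypothesis
    (∀ (ι : Type u) [Fintype ι] (V : ι → Type v) [∀ i, Fintype (V i)]
        (D : Digraph ι) (H : ∀ i, Digraph (V i)),
      2 ≤ Fintype.card ι → Loopless D → (∀ i, Loopless (H i)) →
      ((IsStrong D ∧ IsSymmetric D) ∨
        (IsStrong D ∧ IsSemicomplete D ∧ ¬ IsExceptional (comp D H))) →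
      ∀ k : ℕ, 2 ≤ k → k ≤ Fintype.card (Σ i, V i) →
        (minOrder V : ℕ∞) ≤ lambda (comp D H) k) ∧
    -- sharpness under the first hypothesis
    ((∀ (ι : Type u) [Fintype ι] (D : Digraph ι),
        2 ≤ Fintype.card ι → Loopless D → IsStrong D → IsSymmetric D → minSemidegree D = 1 →
        ∀ r : ℕ, 0 < r → minOrder (fun _ : ι => Fin r) = r ∧
          ∀ k : ℕ, 2 ≤ k → k ≤ Fintype.card (Σ _ : ι, Fin r) →
            lambda (comp D fun _ => arcless r) k = r) ∧
      ∀ t : ℕ, 2 ≤ t → ∃ D : Digraph (Fin t),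
        Loopless D ∧ IsStrong D ∧ IsSymmetric D ∧ minSemidegree D = 1) ∧
    -- sharpness under the second hypothesis
    (∀ r : ℕ, 3 ≤ r →
      Loopless cycle3 ∧ IsStrong cycle3 ∧ IsSemicomplete cycle3 ∧
      ¬ IsExceptional (comp cycle3 fun _ => arcless r) ∧
      minOrder (fun _ : Fin 3 => Fin r) = r ∧
      ∀ k : ℕ, 2 ≤ k → k ≤ Fintype.card (Σ _ : Fin 3, Fin r) →
        lambda (comp cycle3 fun _ => arcless r) k = r) := by
  refine ⟨?_, ⟨?_, ?_⟩, ?_⟩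
  · intro ι _ V _ D H hι hl hH h k hk _
    have : Nontrivial ι := Fintype.one_lt_card_iff_nontrivial.mp hι
    rcases h with ⟨hD, hs⟩ | ⟨hD, hs, hexc⟩
    · obtain ⟨x, y, hxy, hyx⟩ := hD.exists_digon hs
      exact minOrder_le_lambda_of_digon H hl hD hxy hyx hk
    · by_cases h2 : ∃ x y, D.Adj x y ∧ D.Adj y x
      · obtain ⟨x, y, hxy, hyx⟩ := h2
        exact minOrder_le_lambda_of_digon H hl hD hxy hyx hk
      · exact minOrder_le_lambda_of_tournament H hl hH hD hs
          (fun x y hxy hyx => h2 ⟨x, y, hxy, hyx⟩) hexc hk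
  · intro ι _ D hι hl hD hs hmin r hr
    have : Nontrivial ι := Fintype.one_lt_card_iff_nontrivial.mp hι
    refine ⟨minOrder_const r, fun k hk hkV => le_antisymm ?_ ?_⟩
    · obtain ⟨v, w, hv⟩ := exists_outDegree_one hs hmin
      exact lambda_comp_arcless_le hv hr hk hkV
    · obtain ⟨x, y, hxy, hyx⟩ := hD.exists_digon hs
      have := minOrder_le_lambda_of_digon (fun _ => arcless r) hl hD hxy hyx hk
      rwa [minOrder_const] at this
  · intro t ht
    obtain ⟨t, rfl⟩ := Nat.exists_eq_add_of_le' ht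
    exact ⟨starDigraph t, loopless_star t, isStrong_star t, isSymmetric_star t,
      minSemidegree_star t⟩
  · intro r hr
    have hexc := not_isExceptional_of_three_le hr
    refine ⟨loopless_cycle3, isStrong_cycle3, isSemicomplete_cycle3, hexc, minOrder_const r,
      fun k hk hkV => le_antisymm ?_ ?_⟩
    · exact lambda_comp_arcless_le (v := 0) (w := 1) (fun x h => h) (by omega) hk hkV
    · have := minOrder_le_lambda_of_tournament (fun _ => arcless r) loopless_cycle3
        (fun _ _ h => h) isStrong_cycle3 isSemicomplete_cycle3 cycle3_adj_asymm hexc hk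
      rwa [minOrder_const] at this
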